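/- Thompson's group $F$ is the group of piecewise-linear order-preserving bijections of $[0,1]$ with finitely many breakpoints, all dyadic rationals, and all slopes powers of $2$. A tree pair $(S,T)$ consists of two finite rooted binary trees with the same number of carets (internal nodes); this number is its size. It represents the element of $F$ that maps, for every $i$, the dyadic interval of the $i$-th leaf of $S$ affinely onto that of the $i$-th leaf of $T$. A tree pair is reduced if its size is at least $1$ and either its size is $1$ or there is no $i$ such that both trees contain a caret whose children are the leaves numbered $i$ and $i+1$. For $k,n\in\mathbb N$ let $X_k$ be the set of unordered $k$-tuples (multisets) of reduced tree pairs and let $\mathrm{Sph}^{\max}_k(n)\subseteq X_k$ be the finite set of tuples in which the maximal size of a component is $n$. For a group $H$ let $T_H\subseteq X_k$ be the set of tuples whose components generate a subgroup of $F$ isomorphic to $H$. We say that (the isomorphism class of) $H$ is present in $\mathrm{Spec}^{\max}_k(F)$, or visible, if $T_H$ has positive asymptotic density, in the sense that $$\liminf_{n\to\infty}\frac{|T_H\cap \mathrm{Sph}^{\max}_k(n)|}{|\mathrm{Sph}^{\max}_k(n)|}>0 .$$ (If the limit exists, this says that the limit is positive.) $H$ is persistent if there is an $l$ such that $H\in\mathrm{Spec}^{\max}_k(F)$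 for all $k\ge l$. **Theorem (Products with persistent subgroups are persistent).** Let $H$ be present in $\mathrm{Spec}^{\max}_k(F)$, and let $K$ be a persistent subgroup which is present in $\mathrm{Spec}^{\max}_l(F)$ for all $l\ge l_0$. Then $H\times K$ is persistent, and it is present in $\mathrm{Spec}^{\max}_l(F)$ for all $l\ge l_0+k$. -/

import Mathlib

noncomputable section

namespace ThompsonF

/-! ### Thompson's group `F` as a group of piecewise-linear maps of `[0,1]` -/

/-- A real number of the form `m / 2 ^ n`. -/
def IsDyadic (x : ℝ) : Prop := ∃ (m : ℤ) (n : ℕ), x = m / 2 ^ n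

theorem isDyadic_zero : IsDyadic 0 := ⟨0, 0, by simp⟩

theorem IsDyadic.add {x y : ℝ} (hx : IsDyadic x) (hy : IsDyadic y) : IsDyadic (x + y) := by
  obtain ⟨a, m, rfl⟩ := hx
  obtain ⟨b, n, rfl⟩ := hy
  refine ⟨a * 2 ^ n + b * 2 ^ m, m + n, ?_⟩
  push_cast
  rw [pow_add]
  field_simp

theorem IsDyadic.neg {x : ℝ} (hx : IsDyadic x) : IsDyadic (-x) := by
  obtain ⟨a, m, rfl⟩ := hx
  exact ⟨-a, m, by push_cast; ring⟩

theorem IsDyadic.sub {x y : ℝ} (hx : IsDyadic x) (hy : IsDyadic y) : IsDyadic (x - y) := by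
  rw [sub_eq_add_neg]
  exact hx.add hy.neg

theorem IsDyadic.zpow_mul {x : ℝ} (hx : IsDyadic x) (k : ℤ) : IsDyadic ((2 : ℝ) ^ k * x) := by
  obtain ⟨a, m, rfl⟩ := hx
  obtain ⟨n, rfl | rfl⟩ := k.eq_nat_or_neg
  · refine ⟨a * 2 ^ n, m, ?_⟩
    push_cast
    rw [zpow_natCast]
    ring
  · refine ⟨a, m + n, ?_⟩
    rw [zpow_neg, zpow_natCast, pow_add]
    field_simp

/-- `f : [0,1] → [0,1]` is piecewise linear with finitely many breakpoints, all of them dyadic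
rationals, and on every interval without a breakpoint in its interior `f` is affine and its slope is
a power of two. -/
def IsDyadicPL (f : unitInterval ≃o unitInterval) : Prop :=
  ∃ B : Finset unitInterval, (∀ b ∈ B, IsDyadic b) ∧
    ∀ x y : unitInterval, x ≤ y → (∀ b ∈ B, ¬ (x < b ∧ b < y)) →
      ∃ k : ℤ, ∀ z : unitInterval, x ≤ z → z ≤ y →
        (f z : ℝ) = f x + (2 : ℝ) ^ k * ((z : ℝ) - x)

theorem IsDyadicPL.isDyadic_apply_iff {f : unitInterval ≃o unitInterval} (hf : IsDyadicPL f)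
    (x : unitInterval) : IsDyadic (f x : ℝ) ↔ IsDyadic (x : ℝ) := by
  classical
  obtain ⟨B, hB, hf⟩ := hf
  have step : ∀ a x : unitInterval, a ≤ x → (∀ b ∈ B, ¬ (a < b ∧ b < x)) →
      IsDyadic (a : ℝ) → IsDyadic (f a : ℝ) → (IsDyadic (f x : ℝ) ↔ IsDyadic (x : ℝ)) := by
    intro a x hax hb ha hfa
    obtain ⟨k, hk⟩ := hf a x hax hb
    have h := hk x hax le_rfl
    constructor
    · intro hx
      have h2 : (x : ℝ) = a + (2 : ℝ) ^ (-k) * ((f x : ℝ) - f a) := by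
        rw [h, zpow_neg]
        field_simp
        ring
      rw [h2]
      exact ha.add ((hx.sub hfa).zpow_mul _)
    · intro hx
      rw [h]
      exact hfa.add ((hx.sub ha).zpow_mul _)
  have key : ∀ n : ℕ, ∀ x : unitInterval, (B.filter (· < x)).card = n →
      (IsDyadic (f x : ℝ) ↔ IsDyadic (x : ℝ)) := by
    intro n
    induction n using Nat.strong_induction_on with
    | _ n ih =>
      intro x hx
      by_cases hne : (B.filter (· < x)).Nonempty
      · obtain ⟨b, hb, hmax⟩ := (B.filter (· < x)).exists_max_image id hne
        rw [Finset.mem_filter] at hb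
        have hlt : (B.filter (· < b)).card < n := by
          rw [← hx]
          apply Finset.card_lt_card
          rw [Finset.ssubset_iff_of_subset]
          · exact ⟨b, by simp [hb], by simp⟩
          · intro c hc
            rw [Finset.mem_filter] at hc ⊢
            exact ⟨hc.1, hc.2.trans hb.2⟩
        refine step b x hb.2.le ?_ (hB b hb.1) ((ih _ hlt b rfl).2 (hB b hb.1))
        rintro c hc ⟨h1, h2⟩
        exact absurd (hmax c (by simp [hc, h2])) (not_le.2 h1)
      · rw [Finset.not_nonempty_iff_eq_empty, Finset.filter_eq_empty_iff] at hne
        refine step ⊥ x bot_le (fun b hb h => hne hb h.2) ?_ ?_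
        · exact isDyadic_zero
        · rw [map_bot]
          exact isDyadic_zero
  exact key _ x rfl

/-- Thompson's group `F`: the piecewise-linear order-preserving bijections of `[0,1]` whose
breakpoints are dyadic rationals and whose slopes are powers of two, under composition. -/
def F : Subgroup (unitInterval ≃o unitInterval) where
  carrier := {f | IsDyadicPL f}
  one_mem' := ⟨∅, by simp, fun x y _ _ => ⟨0, fun z _ _ => by simp⟩⟩
  mul_mem' := by
    classical
    rintro f g hf hg
    obtain ⟨B, hB, hf'⟩ := hf
    have hg0 := hg
    obtain ⟨C, hC, hg'⟩ := hg
    refine ⟨C ∪ B.image g.symm, ?_, ?_⟩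
    · intro b hb
      rcases Finset.mem_union.1 hb with hb | hb
      · exact hC b hb
      · obtain ⟨c, hc, rfl⟩ := Finset.mem_image.1 hb
        rw [← hg0.isDyadic_apply_iff, OrderIso.apply_symm_apply]
        exact hB c hc
    · intro x y hxy hb
      obtain ⟨k, hk⟩ := hg' x y hxy (fun b h => hb b (Finset.mem_union_left _ h))
      obtain ⟨m, hm⟩ := hf' (g x) (g y) (g.monotone hxy) (by
        rintro b h ⟨h1, h2⟩
        refine hb (g.symm b) (Finset.mem_union_right _ (Finset.mem_image_of_mem _ h)) ⟨?_, ?_⟩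
        · exact (OrderIso.lt_symm_apply g).2 h1
        · exact (OrderIso.symm_apply_lt g).2 h2)
      refine ⟨m + k, fun z hxz hzy => ?_⟩
      have h1 := hk z hxz hzy
      have h2 := hm (g z) (g.monotone hxz) (g.monotone hzy)
      rw [RelIso.mul_apply, RelIso.mul_apply, h2, h1, zpow_add₀ (by norm_num)]
      ring
  inv_mem' := by
    classical
    rintro f hf
    have hf0 := hf
    obtain ⟨B, hB, hf'⟩ := hf
    refine ⟨B.image f, ?_, ?_⟩
    · intro b hb
      obtain ⟨c, hc, rfl⟩ := Finset.mem_image.1 hb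
      exact (hf0.isDyadic_apply_iff c).2 (hB c hc)
    · intro x y hxy hb
      obtain ⟨k, hk⟩ := hf' (f.symm x) (f.symm y) (f.symm.monotone hxy) (by
        rintro b h ⟨h1, h2⟩
        refine hb (f b) (Finset.mem_image_of_mem _ h) ⟨?_, ?_⟩
        · exact (OrderIso.symm_apply_lt f).1 h1
        · exact (OrderIso.lt_symm_apply f).1 h2)
      refine ⟨-k, fun z hxz hzy => ?_⟩
      have h := hk (f.symm z) (f.symm.monotone hxz) (f.symm.monotone hzy)
      rw [OrderIso.apply_symm_apply, OrderIso.apply_symm_apply] at h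
      change (f.symm z : ℝ) = f.symm x + (2 : ℝ) ^ (-k) * ((z : ℝ) - x)
      rw [h, zpow_neg]
      field_simp
      ring

/-! ### Tree pairs -/

/-- For a finite rooted binary tree `t` with leaves numbered `0, …, n` from left to right, this map
is affine on each `[i, i + 1]`, `0 ≤ i ≤ n`, and carries it onto the dyadic subinterval of `[0,1]`
that belongs to leaf `i`: the root carries `[0,1]`, and the two children of a vertex carry the two
halves of its interval. (Outside `[0, n + 1]` the values play no role.) -/
def leafMap : BinaryTree Unit → ℝ → ℝ
  | .nil, x => x
  | .node _ l r, x =>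
      if x ≤ l.numLeaves then leafMap l x / 2 else 1 / 2 + leafMap r (x - l.numLeaves) / 2

theorem leafMap_zero (t : BinaryTree Unit) : leafMap t 0 = 0 := by
  induction t with
  | nil => rfl
  | node _ l r hl hr => simp [leafMap, hl]

theorem leafMap_numLeaves (t : BinaryTree Unit) : leafMap t t.numLeaves = 1 := by
  induction t with
  | nil => simp [leafMap]
  | node _ l r hl hr =>
    have h : (0 : ℝ) < r.numLeaves := by
      rw [BinaryTree.numLeaves_eq_numNodes_succ]
      positivity
    simp only [leafMap, BinaryTree.numLeaves, Nat.cast_add]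
    rw [if_neg (by linarith), add_sub_cancel_left, hr]
    norm_num

theorem leafMap_strictMono (t : BinaryTree Unit) : StrictMono (leafMap t) := by
  induction t with
  | nil => exact fun x y h => h
  | node _ l r hl hr =>
    intro x y hxy
    simp only [leafMap]
    split_ifs with h1 h2 h2
    · have := hl hxy
      linarith
    · have h3 := hl.monotone h1
      have h4 := hr (show (0 : ℝ) < y - l.numLeaves by linarith)
      rw [leafMap_numLeaves] at h3
      rw [leafMap_zero] at h4
      linarith
    · linarith
    · have := hr (sub_lt_sub_right hxy (l.numLeaves : ℝ))
      linarith

theorem leafMap_surjective (t : BinaryTree Unit) : Function.Surjective (leafMap t) := by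
  induction t with
  | nil => exact fun x => ⟨x, rfl⟩
  | node _ l r hl hr =>
    intro y
    by_cases hy : y ≤ 1 / 2
    · obtain ⟨x, hx⟩ := hl (2 * y)
      refine ⟨x, ?_⟩
      have h : x ≤ l.numLeaves := by
        rw [← (leafMap_strictMono l).le_iff_le, leafMap_numLeaves]
        linarith
      simp only [leafMap, if_pos h, hx]
      ring
    · obtain ⟨x, hx⟩ := hr (2 * y - 1)
      refine ⟨x + l.numLeaves, ?_⟩
      have h : 0 < x := by
        rw [← (leafMap_strictMono r).lt_iff_lt, leafMap_zero]
        linarith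
      simp only [leafMap]
      rw [if_neg (by linarith), add_sub_cancel_right, hx]
      ring

/-- `leafMap` as an order isomorphism. -/
def leafIso (t : BinaryTree Unit) : ℝ ≃o ℝ :=
  (leafMap_strictMono t).orderIsoOfSurjective _ (leafMap_surjective t)

theorem leafIso_apply (t : BinaryTree Unit) (x : ℝ) : leafIso t x = leafMap t x := rfl

theorem leafIso_zero (t : BinaryTree Unit) : leafIso t 0 = 0 := leafMap_zero t

theorem leafIso_numLeaves (t : BinaryTree Unit) : leafIso t t.numLeaves = 1 := leafMap_numLeaves t

theorem leafMap_affine (t : BinaryTree Unit) (i : ℤ) :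
    ∃ k : ℤ, ∀ x y : ℝ, (i : ℝ) ≤ x → x ≤ y → y ≤ i + 1 →
      leafMap t y = leafMap t x + (2 : ℝ) ^ k * (y - x) := by
  induction t generalizing i with
  | nil => exact ⟨0, fun x y _ _ _ => by simp [leafMap]⟩
  | node _ l r hl hr =>
    have h2 : (2 : ℝ) ≠ 0 := by norm_num
    by_cases hi : i + 1 ≤ (l.numLeaves : ℤ)
    · obtain ⟨k, hk⟩ := hl i
      have hi' : (i : ℝ) + 1 ≤ l.numLeaves := by exact_mod_cast hi
      refine ⟨k - 1, fun x y h1 h3 h4 => ?_⟩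
      simp only [leafMap]
      rw [if_pos (by linarith), if_pos (by linarith), hk x y h1 h3 h4, zpow_sub_one₀ h2]
      ring
    · obtain ⟨k, hk⟩ := hr (i - l.numLeaves)
      have hi' : (l.numLeaves : ℝ) ≤ i := by
        have : (l.numLeaves : ℤ) ≤ i := by omega
        exact_mod_cast this
      have hval : ∀ x : ℝ, (i : ℝ) ≤ x →
          leafMap (.node () l r) x = 1 / 2 + leafMap r (x - l.numLeaves) / 2 := by
        intro x hx
        simp only [leafMap]
        split_ifs with h
        · have hx' : x = l.numLeaves := by linarith
          rw [hx', leafMap_numLeaves, sub_self, leafMap_zero]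
          norm_num
        · rfl
      refine ⟨k - 1, fun x y h1 h3 h4 => ?_⟩
      have := hk (x - l.numLeaves) (y - l.numLeaves) (by push_cast; linarith) (by linarith)
        (by push_cast; linarith)
      rw [hval x h1, hval y (h1.trans h3), this, zpow_sub_one₀ h2]
      ring

theorem leafMap_isDyadic (t : BinaryTree Unit) (i : ℤ) : IsDyadic (leafMap t i) := by
  have half : ∀ x : ℝ, IsDyadic x → IsDyadic (x / 2) := by
    intro x hx
    have := hx.zpow_mul (-1)
    rwa [zpow_neg_one, inv_mul_eq_div] at this
  induction t generalizing i with
  | nil => exact ⟨i, 0, by simp [leafMap]⟩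
  | node _ l r hl hr =>
    simp only [leafMap]
    split_ifs with h
    · exact half _ (hl i)
    · have := hr (i - l.numLeaves)
      push_cast at this
      exact (half 1 ⟨1, 0, by simp⟩).add (half _ this)

/-- A pair of finite rooted binary trees with the same number of carets (internal nodes). -/
structure TreePair where
  domainTree : BinaryTree Unit
  rangeTree : BinaryTree Unit
  numNodes_eq : domainTree.numNodes = rangeTree.numNodes

/-- The size of a tree pair: the number of carets of either tree. -/
def TreePair.size (p : TreePair) : ℕ := p.domainTree.numNodes

/-- `HasExposedCaret t i`: the tree `t`, with its leaves numbered `0, 1, 2, …` from left to right,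
contains a caret both of whose children are leaves, these leaves having the numbers `i` and
`i + 1`. -/
def HasExposedCaret : BinaryTree Unit → ℕ → Prop
  | .nil, _ => False
  | .node _ l r, i =>
      (l = .nil ∧ r = .nil ∧ i = 0) ∨ HasExposedCaret l i ∨
        ∃ j, HasExposedCaret r j ∧ i = l.numLeaves + j

/-- A tree pair is reduced if it is nonempty and, unless it is a pair of single carets, the two
trees have no exposed caret with the same leaf numbers in common. -/
def TreePair.IsReduced (p : TreePair) : Prop :=
  1 ≤ p.size ∧
    (2 ≤ p.size → ¬ ∃ i, HasExposedCaret p.domainTree i ∧ HasExposedCaret p.rangeTree i)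

/-- Reduced tree pairs. -/
def ReducedTreePair : Type := {p : TreePair // p.IsReduced}

theorem TreePair.numLeaves_eq (p : TreePair) :
    p.domainTree.numLeaves = p.rangeTree.numLeaves := by
  rw [BinaryTree.numLeaves_eq_numNodes_succ, BinaryTree.numLeaves_eq_numNodes_succ, p.numNodes_eq]

theorem leafIso_trans_mem (S T : BinaryTree Unit) (h : S.numLeaves = T.numLeaves) {x : ℝ}
    (hx : x ∈ unitInterval) : leafIso T ((leafIso S).symm x) ∈ unitInterval := by
  constructor
  · rw [← leafIso_zero T, (leafIso T).le_iff_le, OrderIso.le_symm_apply, leafIso_zero]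
    exact hx.1
  · rw [← leafIso_numLeaves T, (leafIso T).le_iff_le, OrderIso.symm_apply_le, ← h,
      leafIso_numLeaves]
    exact hx.2

/-- The piecewise-linear map of `[0,1]` given by a tree pair `(S, T)`: for each `i` it carries the
interval of leaf `i` of `S` affinely onto the interval of leaf `i` of `T`. -/
def TreePair.toOrderIso (p : TreePair) : unitInterval ≃o unitInterval where
  toFun x := ⟨leafIso p.rangeTree ((leafIso p.domainTree).symm x),
    leafIso_trans_mem _ _ p.numLeaves_eq x.2⟩
  invFun x := ⟨leafIso p.domainTree ((leafIso p.rangeTree).symm x),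
    leafIso_trans_mem _ _ p.numLeaves_eq.symm x.2⟩
  left_inv x := by simp
  right_inv x := by simp
  map_rel_iff' := by
    intro x y
    simp [← Subtype.coe_le_coe]

theorem TreePair.isDyadicPL (p : TreePair) : IsDyadicPL p.toOrderIso := by
  classical
  let S := p.domainTree
  let T := p.rangeTree
  have hmem : ∀ i : Fin (S.numLeaves + 1), leafMap S ((i : ℕ) : ℝ) ∈ unitInterval := by
    intro i
    have hi : (i : ℕ) ≤ S.numLeaves := Nat.lt_succ_iff.1 i.2
    constructor
    · rw [← leafMap_zero S]
      exact (leafMap_strictMono S).monotone (by positivity)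
    · rw [← leafMap_numLeaves S]
      exact (leafMap_strictMono S).monotone (by exact_mod_cast hi)
  refine ⟨Finset.univ.image fun i : Fin (S.numLeaves + 1) =>
    (⟨leafMap S ((i : ℕ) : ℝ), hmem i⟩ : unitInterval), ?_, ?_⟩
  · intro b hb
    obtain ⟨i, -, rfl⟩ := Finset.mem_image.1 hb
    exact_mod_cast leafMap_isDyadic S (i : ℕ)
  · intro x y hxy hb
    rcases hxy.eq_or_lt with rfl | hlt
    · refine ⟨0, fun z h1 h2 => ?_⟩
      rw [le_antisymm h2 h1]
      simp
    set u := (leafIso S).symm x with hu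
    set v := (leafIso S).symm y with hv
    have huv : u < v := (leafIso S).symm.strictMono hlt
    have hu0 : 0 ≤ u := by
      rw [hu, OrderIso.le_symm_apply, leafIso_zero]
      exact x.2.1
    have hvn : v ≤ S.numLeaves := by
      rw [hv, OrderIso.symm_apply_le, leafIso_numLeaves]
      exact y.2.2
    have hn0 : 0 ≤ ⌊u⌋ := Int.floor_nonneg.2 hu0
    obtain ⟨n, hn⟩ := Int.eq_ofNat_of_zero_le hn0
    have hn1 : (n : ℝ) ≤ u := by
      have := Int.floor_le u
      rw [hn] at this
      exact_mod_cast this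
    have hn2 : u < (n : ℝ) + 1 := by
      have := Int.lt_floor_add_one u
      rw [hn] at this
      exact_mod_cast this
    have hvle : v ≤ (n : ℝ) + 1 := by
      by_contra hcon
      rw [not_le] at hcon
      have hle : n + 1 < S.numLeaves + 1 := by
        have : ((n + 1 : ℕ) : ℝ) < ((S.numLeaves + 1 : ℕ) : ℝ) := by
          push_cast
          linarith
        exact_mod_cast this
      refine hb ⟨leafMap S ((n + 1 : ℕ) : ℝ), hmem ⟨n + 1, hle⟩⟩
        (Finset.mem_image.2 ⟨⟨n + 1, hle⟩, Finset.mem_univ _, rfl⟩) ⟨?_, ?_⟩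
      · rw [← Subtype.coe_lt_coe]
        change (x : ℝ) < leafIso S ((n + 1 : ℕ) : ℝ)
        rw [← OrderIso.symm_apply_lt]
        push_cast
        exact hn2
      · rw [← Subtype.coe_lt_coe]
        change leafIso S ((n + 1 : ℕ) : ℝ) < (y : ℝ)
        rw [← OrderIso.lt_symm_apply]
        push_cast
        exact hcon
    obtain ⟨k, hk⟩ := leafMap_affine S n
    obtain ⟨m, hm⟩ := leafMap_affine T n
    refine ⟨m - k, fun z hxz hzy => ?_⟩
    set w := (leafIso S).symm z with hw
    have huw : u ≤ w := (leafIso S).symm.monotone hxz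
    have hwv : w ≤ v := (leafIso S).symm.monotone hzy
    have e1 := hk u w (by exact_mod_cast hn1) huw (by push_cast; linarith)
    have e2 := hm u w (by exact_mod_cast hn1) huw (by push_cast; linarith)
    have hx' : leafMap S u = x := (leafIso S).apply_symm_apply x
    have hz' : leafMap S w = z := (leafIso S).apply_symm_apply z
    rw [hx', hz'] at e1
    change leafMap T w = leafMap T u + _
    rw [e2, e1, zpow_sub₀ (by norm_num)]
    field_simp
    ring

/-- The element of `F` represented by a tree pair. -/
def TreePair.toF (p : TreePair) : F := ⟨p.toOrderIso, p.isDyadicPL⟩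

/-! ### The max stratification and the subgroup spectrum -/

/-- The sphere of radius `n` in the set of unordered `k`-tuples of reduced tree pairs: the tuples in
which the maximal size of a component is `n`. -/
def sphMax (k n : ℕ) : Set (Sym ReducedTreePair k) :=
  {t | (∀ p ∈ t, p.1.size ≤ n) ∧ ∃ p ∈ t, p.1.size = n}

/-- The subgroup of `F` generated by the components of an unordered tuple. -/
def generatedSubgroup {k : ℕ} (t : Sym ReducedTreePair k) : Subgroup F :=
  Subgroup.closure {f | ∃ p ∈ t, p.1.toF = f}

/-- The unordered `k`-tuples of reduced tree pairs that generate a subgroup isomorphic to `H`. -/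
def generatingTuples (k : ℕ) (H : Type*) [Group H] : Set (Sym ReducedTreePair k) :=
  {t | Nonempty (generatedSubgroup t ≃* H)}

/-- The proportion of a set `A` of unordered `k`-tuples in the sphere of radius `n`. -/
def proportion {k : ℕ} (A : Set (Sym ReducedTreePair k)) (n : ℕ) : ℝ :=
  ((A ∩ sphMax k n).ncard : ℝ) / ((sphMax k n).ncard : ℝ)

/-- `A` has asymptotic density `d` with respect to the max stratification. -/
def HasDensity {k : ℕ} (A : Set (Sym ReducedTreePair k)) (d : ℝ) : Prop :=
  Filter.Tendsto (proportion A) Filter.atTop (nhds d)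

/-- The lower asymptotic density of `A` with respect to the max stratification. -/
def lowerDensity {k : ℕ} (A : Set (Sym ReducedTreePair k)) : ℝ :=
  Filter.liminf (proportion A) Filter.atTop

/-- `H` (its isomorphism class) is visible, that is, it lies in the `k`-subgroup spectrum of `F`
with respect to the max stratification: the tuples generating a copy of `H` have positive (lower)
asymptotic density. -/
def InSpecMax (k : ℕ) (H : Type*) [Group H] : Prop :=
  0 < lowerDensity (generatingTuples k H)

/-- `H` is persistent: it lies in the `k`-spectrum for all sufficiently large `k`. -/
def IsPersistent (H : Type*) [Group H] : Prop :=
  ∃ l : ℕ, ∀ k : ℕ, l ≤ k → InSpecMax k H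

/-- The spheres are finite sets. -/
theorem sphMax_finite (k n : ℕ) : (sphMax k n).Finite := by
  classical
  have h1 : {p : ReducedTreePair | p.1.size ≤ n}.Finite := by
    let U : Finset (BinaryTree Unit) :=
      (Finset.range (n + 1)).biUnion BinaryTree.treesOfNumNodesEq
    have hinj : Function.Injective
        (fun p : ReducedTreePair => (p.1.domainTree, p.1.rangeTree)) := by
      rintro ⟨⟨a, b, _⟩, _⟩ ⟨⟨c, d, _⟩, _⟩ h
      simp only [Prod.mk.injEq] at h
      obtain ⟨rfl, rfl⟩ := h
      rfl
    refine Set.Finite.of_finite_image (f := fun p : ReducedTreePair =>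
      (p.1.domainTree, p.1.rangeTree)) ((U ×ˢ U).finite_toSet.subset ?_) hinj.injOn
    rintro _ ⟨p, hp, rfl⟩
    have hp : p.1.domainTree.numNodes ≤ n := hp
    have hp' := hp
    rw [p.1.numNodes_eq] at hp'
    simp [U, hp, hp']
  have : Finite {p : ReducedTreePair // p.1.size ≤ n} := h1
  have := Fintype.ofFinite {p : ReducedTreePair // p.1.size ≤ n}
  refine (Set.finite_range (fun s : Sym {p : ReducedTreePair // p.1.size ≤ n} k =>
    s.map Subtype.val)).subset ?_
  intro t ht
  refine ⟨t.attach.map fun p => ⟨p.1, ht.1 p.1 p.2⟩, ?_⟩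
  simp only
  rw [Sym.map_map]
  exact t.attach_map_coe

/-- If the tuples generating a copy of `H` have an asymptotic density, then `H` lies in the spectrum
if and only if this density is positive. -/
theorem inSpecMax_iff_of_hasDensity {k : ℕ} {H : Type*} [Group H] {d : ℝ}
    (h : HasDensity (generatingTuples k H) d) : InSpecMax k H ↔ 0 < d := by
  unfold InSpecMax lowerDensity
  rw [Filter.Tendsto.liminf_eq h]

end ThompsonF

end

/-! Two copies of `F` acting on the two halves of `[0,1]` commute and intersect trivially. Squeezing
a `k`-tuple generating `H` into the left half and an `l`-tuple generating `K` into the right half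
therefore gives a `(k + l)`-tuple generating `H × K`. On tree pairs this hangs the given trees below
a new root, so it adds one caret and maps spheres of radius `n` to the sphere of radius `n + 1`. Its
fibres have at most `2 ^ (k + l)` elements. Visibility of `H × K` thus follows once the sphere of
radius `n + 1` in the `(k + l)`-tuples is at most a constant times the product of the two spheres of
radius `n`.

With `r n` the number of reduced pairs of size `n`, a sphere of `k`-tuples lies between `r n ^ k /
k!` and the `k`-th power of the number of pairs of size at most `n`. So it suffices to bound the
number of pairs of size at most `n + 1` by a constant times `r n`
(`exists_ncard_reducedUpTo_succ_le`). The two placements below a root give `2 * r n ≤ r (n + 1)`, so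
partial sums of `r` are comparable to their last term, and only an upper bound on the growth of the
partial sums remains.

That bound comes from generating functions. Inclusion and exclusion over common exposed carets gives
`∑ r n x^n = (1 - x) G(x (1 - x))`, up to terms of degree at most one, with `G(z) = ∑ (catalan m)^2
z^m`. The partial sums of `r` are thus essentially the coefficients of `G(x (1 - x))`. The
recurrence of the Catalan numbers makes `G` satisfy a second-order linear differential equation. The
resulting recurrence for the partial sums has leading coefficient of order `n ^ 2` and all others
`O(n ^ 2)`, so consecutive partial sums have bounded ratio (`exists_sum_numIrreducible_succ_le`). -/

noncomputable section

namespace ThompsonF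

open BinaryTree Finset

/-! ### Attaching a caret to a leaf -/

/-- The tree obtained from `t` by attaching a caret to the leaf numbered `i`. -/
def graft : BinaryTree Unit → ℕ → BinaryTree Unit
  | .nil, _ => .node () .nil .nil
  | .node _ l r, i =>
      if i < l.numLeaves then .node () (graft l i) r else .node () l (graft r (i - l.numLeaves))

theorem graft_ne_nil (t : BinaryTree Unit) (i : ℕ) : graft t i ≠ .nil := by
  cases t with
  | nil => simp [graft]
  | node _ l r => simp only [graft]; split_ifs <;> simp

theorem numNodes_graft (t : BinaryTree Unit) (i : ℕ) :
    (graft t i).numNodes = t.numNodes + 1 := by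
  induction t generalizing i with
  | nil => rfl
  | node _ l r hl hr =>
    simp only [graft]
    split_ifs
    · simp only [numNodes, hl]; omega
    · simp only [numNodes, hr]; omega

theorem numLeaves_graft (t : BinaryTree Unit) (i : ℕ) :
    (graft t i).numLeaves = t.numLeaves + 1 := by
  rw [numLeaves_eq_numNodes_succ, numLeaves_eq_numNodes_succ, numNodes_graft]

theorem HasExposedCaret.lt_numLeaves {t : BinaryTree Unit} {i : ℕ} (h : HasExposedCaret t i) :
    i + 1 < t.numLeaves := by
  induction t generalizing i with
  | nil => exact h.elim
  | node _ l r hl hr =>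
    have h1 := l.numLeaves_pos
    have h2 := r.numLeaves_pos
    simp only [numLeaves]
    rcases h with ⟨rfl, rfl, rfl⟩ | h | ⟨j, h, rfl⟩
    · simp [numLeaves]
    · have := hl h; omega
    · have := hr h; omega

theorem HasExposedCaret.lt_numNodes {t : BinaryTree Unit} {i : ℕ} (h : HasExposedCaret t i) :
    i < t.numNodes := by
  have := h.lt_numLeaves
  rw [numLeaves_eq_numNodes_succ] at this
  omega

/-- Two such carets would share the leaf `i + 1`. Hence only position sets without consecutive
elements matter in the inclusion-exclusion sum. -/
theorem HasExposedCaret.not_succ {t : BinaryTree Unit} {i : ℕ} (h : HasExposedCaret t i) :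
    ¬ HasExposedCaret t (i + 1) := by
  induction t generalizing i with
  | nil => exact h.elim
  | node _ l r hl hr =>
    rintro h'
    rcases h with ⟨rfl, rfl, rfl⟩ | h | ⟨j, h, rfl⟩
    · rcases h' with ⟨-, -, h'⟩ | h' | ⟨_, h', -⟩
      · simp at h'
      · exact h'
      · exact h'
    · have h1 := h.lt_numLeaves
      rcases h' with ⟨-, -, h'⟩ | h' | ⟨_, h', h2⟩
      · simp at h'
      · exact hl h h'
      · omega
    · rcases h' with ⟨-, -, h'⟩ | h' | ⟨m, h', h2⟩
      · simp at h'
      · have := h'.lt_numLeaves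
        omega
      · obtain rfl : m = j + 1 := by omega
        exact hr h h'

theorem hasExposedCaret_graft_self {t : BinaryTree Unit} {i : ℕ} (hi : i < t.numLeaves) :
    HasExposedCaret (graft t i) i := by
  induction t generalizing i with
  | nil =>
    simp only [numLeaves] at hi
    exact Or.inl ⟨rfl, rfl, by omega⟩
  | node _ l r hl hr =>
    simp only [numLeaves] at hi
    simp only [graft]
    split_ifs with h
    · exact Or.inr (Or.inl (hl h))
    · exact Or.inr (Or.inr ⟨_, hr (by omega), by omega⟩)

/-- Grafting at `i` leaves everything to the left of leaf `i` in place and keeps its numbering. -/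
theorem hasExposedCaret_graft_of_lt {t : BinaryTree Unit} {i j : ℕ} (hi : i < t.numLeaves)
    (hj : j + 1 < i) : HasExposedCaret (graft t i) j ↔ HasExposedCaret t j := by
  induction t generalizing i j with
  | nil => simp only [numLeaves] at hi; omega
  | node _ l r hl hr =>
    simp only [numLeaves] at hi
    simp only [graft]
    split_ifs with h
    · simp only [HasExposedCaret, graft_ne_nil, false_and, false_or, hl h hj]
      constructor
      · rintro (h' | ⟨m, -, h'⟩)
        · exact Or.inr (Or.inl h')
        · rw [numLeaves_graft] at h'; omega
      · rintro (⟨rfl, -, -⟩ | h' | ⟨m, -, h'⟩)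
        · simp only [numLeaves] at h; omega
        · exact Or.inl h'
        · omega
    · simp only [HasExposedCaret, graft_ne_nil, false_and, and_false, false_or]
      constructor
      · rintro (h' | ⟨m, h', rfl⟩)
        · exact Or.inr (Or.inl h')
        · exact Or.inr (Or.inr ⟨m, (hr (by omega) (by omega)).1 h', rfl⟩)
      · rintro (⟨rfl, rfl, -⟩ | h' | ⟨m, h', rfl⟩)
        · simp only [numLeaves] at hi h; omega
        · exact Or.inl h'
        · exact Or.inr ⟨m, (hr (by omega) (by omega)).2 h', rfl⟩

theorem graft_injective {s t : BinaryTree Unit} {i : ℕ} (hs : i < s.numLeaves)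
    (ht : i < t.numLeaves) (h : graft s i = graft t i) : s = t := by
  induction s generalizing t i with
  | nil =>
    cases t with
    | nil => rfl
    | node _ l r =>
      simp only [graft] at h
      split_ifs at h
      · simp only [node.injEq, true_and] at h
        exact (graft_ne_nil _ _ h.1.symm).elim
      · simp only [node.injEq, true_and] at h
        exact (graft_ne_nil _ _ h.2.symm).elim
  | node _ l r hl hr =>
    cases t with
    | nil =>
      simp only [graft] at h
      split_ifs at h
      · simp only [node.injEq, true_and] at h
        exact (graft_ne_nil _ _ h.1).elim
      · simp only [node.injEq, true_and] at h
        exact (graft_ne_nil _ _ h.2).elim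
    | node _ l' r' =>
      simp only [numLeaves] at hs ht
      simp only [graft] at h
      split_ifs at h with h1 h2 h2 <;> simp only [node.injEq, true_and] at h
      · rw [hl h1 h2 h.1, h.2]
      · have := congrArg numLeaves h.1
        rw [numLeaves_graft] at this
        omega
      · have := congrArg numLeaves h.1
        rw [numLeaves_graft] at this
        omega
      · obtain ⟨rfl, h⟩ := h
        rw [hr (by omega) (by omega) h]

/-- Together with `graft_injective` this makes deletion of an exposed caret a bijection. -/
theorem HasExposedCaret.exists_graft {t : BinaryTree Unit} {i : ℕ} (h : HasExposedCaret t i) :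
    ∃ s, i < s.numLeaves ∧ graft s i = t := by
  induction t generalizing i with
  | nil => exact h.elim
  | node _ l r hl hr =>
    rcases h with ⟨rfl, rfl, rfl⟩ | h | ⟨j, h, rfl⟩
    · exact ⟨.nil, by simp [numLeaves], rfl⟩
    · obtain ⟨s, h1, rfl⟩ := hl h
      refine ⟨.node () s r, by simp only [numLeaves]; omega, ?_⟩
      simp only [graft, if_pos h1]
    · obtain ⟨s, h1, rfl⟩ := hr h
      refine ⟨.node () l s, by simp only [numLeaves]; omega, ?_⟩
      simp [graft]

/-! ### Counting irreducible tree pairs by inclusion and exclusion -/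

open Classical in
/-- The trees with `n` carets that have an exposed caret at every position in `A`. -/
def treesExposedOn (n : ℕ) (A : Finset ℕ) : Finset (BinaryTree Unit) :=
  (treesOfNumNodesEq n).filter fun t => ∀ a ∈ A, HasExposedCaret t a

theorem mem_treesExposedOn {n : ℕ} {A : Finset ℕ} {t : BinaryTree Unit} :
    t ∈ treesExposedOn n A ↔ t.numNodes = n ∧ ∀ a ∈ A, HasExposedCaret t a := by
  simp [treesExposedOn]

theorem card_treesExposedOn_empty (n : ℕ) : #(treesExposedOn n ∅) = catalan n := by
  simp [treesExposedOn, treesOfNumNodesEq_card_eq_catalan]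

theorem treesExposedOn_insert_insert (n a : ℕ) (A : Finset ℕ) :
    treesExposedOn n (insert (a + 1) (insert a A)) = ∅ := by
  rw [eq_empty_iff_forall_notMem]
  intro t ht
  rw [mem_treesExposedOn] at ht
  exact (ht.2 a (by simp)).not_succ (ht.2 (a + 1) (by simp))

/-- Deleting the rightmost prescribed caret does not affect the others, which lie strictly to its
left. -/
theorem card_treesExposedOn_insert {n a : ℕ} (ha : a ≤ n) {A : Finset ℕ}
    (hA : ∀ b ∈ A, b + 1 < a) : #(treesExposedOn (n + 1) (insert a A)) = #(treesExposedOn n A) := by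
  symm
  refine card_bij (fun t _ => graft t a) ?_ ?_ ?_
  · intro t ht
    rw [mem_treesExposedOn] at ht ⊢
    have h : a < t.numLeaves := by rw [numLeaves_eq_numNodes_succ]; omega
    refine ⟨by rw [numNodes_graft, ht.1], fun b hb => ?_⟩
    rcases mem_insert.1 hb with rfl | hb
    · exact hasExposedCaret_graft_self h
    · exact (hasExposedCaret_graft_of_lt h (hA b hb)).2 (ht.2 b hb)
  · intro s hs t ht h
    rw [mem_treesExposedOn] at hs ht
    refine graft_injective ?_ ?_ h <;> rw [numLeaves_eq_numNodes_succ] <;> omega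
  · intro t ht
    rw [mem_treesExposedOn] at ht
    obtain ⟨s, hs, rfl⟩ := (ht.2 a (by simp)).exists_graft
    refine ⟨s, ?_, rfl⟩
    rw [mem_treesExposedOn]
    refine ⟨by rw [numNodes_graft] at ht; omega, fun b hb => ?_⟩
    exact (hasExposedCaret_graft_of_lt hs (hA b hb)).1 (ht.2 b (by simp [hb]))

/-- The alternating sum over `A ⊆ {0, …, a - 1}` of the number of pairs of trees with `n` carets
that both have an exposed caret at every position in `A`. -/
def signedCount (n a : ℕ) : ℤ :=
  ∑ A ∈ (range a).powerset, (-1) ^ #A * (#(treesExposedOn n A) : ℤ) ^ 2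

theorem signedCount_zero (n : ℕ) : signedCount n 0 = (catalan n : ℤ) ^ 2 := by
  simp [signedCount, card_treesExposedOn_empty]

/-- Split the sets by whether they contain `a`. Those that do contribute only if they avoid `a - 1`,
and then the caret at `a` can be deleted at the cost of a sign. -/
theorem signedCount_succ {n a : ℕ} (ha : a ≤ n) :
    signedCount (n + 1) (a + 1) = signedCount (n + 1) a - signedCount n (a - 1) := by
  have key : ∑ A ∈ (range a).powerset,
      (-1 : ℤ) ^ #(insert a A) * (#(treesExposedOn (n + 1) (insert a A)) : ℤ) ^ 2 =
      - signedCount n (a - 1) := by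
    have step : ∀ b, b ≤ a → (∀ c ∈ range b, c + 1 < a) →
        ∑ A ∈ (range b).powerset,
          (-1 : ℤ) ^ #(insert a A) * (#(treesExposedOn (n + 1) (insert a A)) : ℤ) ^ 2 =
        - signedCount n b := by
      intro b hb hc
      rw [signedCount, ← sum_neg_distrib]
      refine sum_congr rfl fun A hA => ?_
      rw [mem_powerset] at hA
      rw [card_treesExposedOn_insert ha fun b hb => hc b (hA hb), card_insert_of_notMem, pow_succ]
      · ring
      · intro h
        have := mem_range.1 (hA h)
        omega
    cases a with
    | zero => exact step 0 le_rfl (by simp)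
    | succ a =>
      rw [range_add_one, sum_powerset_insert (by simp), step a (by omega) (by simp)]
      -- The sets that also contain the neighbouring position contribute zero.
      simp [treesExposedOn_insert_insert]
  rw [signedCount, range_add_one, sum_powerset_insert (by simp), key, ← sub_eq_add_neg]
  rfl

/-- The binomial coefficient counts the `j`-subsets of `{0, …, a - 1}` without consecutive elements;
deleting `j` carets leaves `n - j`. The induction is Pascal's rule. -/
theorem signedCount_eq_sum {n a : ℕ} (ha : a ≤ n) :
    signedCount n a =
      ∑ j ∈ range (n + 1), (-1 : ℤ) ^ j * ((a + 1 - j).choose j * (catalan (n - j) : ℤ) ^ 2) := by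
  induction a using Nat.strong_induction_on generalizing n with
  | _ a ih =>
    cases a with
    | zero =>
      rw [signedCount_zero, sum_range_succ', sum_eq_zero]
      · simp
      · intro j _
        simp
    | succ a =>
      obtain ⟨n, rfl⟩ : ∃ m, n = m + 1 := ⟨n - 1, by omega⟩
      rw [signedCount_succ (by omega), ih a (by omega) (by omega), ih (a - 1) (by omega) (by omega),
        sum_range_succ', sum_range_succ' _ (n + 1), add_sub_right_comm, ← sum_sub_distrib]
      congr 1
      refine sum_congr rfl fun j _ => ?_
      have h : ((a + 1 + 1 - (j + 1)).choose (j + 1) : ℤ) =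
          (a + 1 - (j + 1)).choose (j + 1) + (a - 1 + 1 - j).choose j := by
        norm_cast
        -- For `a < j` the truncated differences vanish, and so do all three binomial coefficients.
        rcases Nat.lt_or_ge a j with hj | hj
        · obtain ⟨j, rfl⟩ : ∃ m, j = m + 1 := ⟨j - 1, by omega⟩
          rw [show a + 1 + 1 - (j + 1 + 1) = 0 by omega,
            show a + 1 - (j + 1 + 1) = 0 by omega, show a - 1 + 1 - (j + 1) = 0 by omega]
          simp
        · rw [show a + 1 + 1 - (j + 1) = (a - j) + 1 by omega,
            show a + 1 - (j + 1) = a - j by omega, Nat.choose_succ_succ, add_comm]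
          congr 1
          rcases a with _ | a
          · obtain rfl : j = 0 := by omega
            simp
          · simp
      rw [h, show n + 1 - (j + 1) = n - j by omega, pow_succ]
      ring

open Classical in
/-- The number of pairs of trees with `n` carets without a common exposed caret. -/
def numIrreducible (n : ℕ) : ℕ :=
  #((treesOfNumNodesEq n ×ˢ treesOfNumNodesEq n).filter fun p =>
    ¬ ∃ i, HasExposedCaret p.1 i ∧ HasExposedCaret p.2 i)

/-- The alternating sum over all subsets of the set of common exposed positions is `1` if that set
is empty and `0` otherwise. All positions lie below `n`. -/
theorem numIrreducible_eq_signedCount (n : ℕ) : (numIrreducible n : ℤ) = signedCount n n := by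
  classical
  have h1 : (numIrreducible n : ℤ) = ∑ p ∈ treesOfNumNodesEq n ×ˢ treesOfNumNodesEq n,
      ∑ A ∈ (range n).powerset,
        if (∀ a ∈ A, HasExposedCaret p.1 a) ∧ (∀ a ∈ A, HasExposedCaret p.2 a) then
          (-1 : ℤ) ^ #A else 0 := by
    rw [numIrreducible, card_filter]
    push_cast
    refine sum_congr rfl fun p hp => ?_
    rw [mem_product, mem_treesOfNumNodesEq, mem_treesOfNumNodesEq] at hp
    rw [← sum_filter]
    have h2 : ((range n).powerset.filter fun A : Finset ℕ =>
        (∀ a ∈ A, HasExposedCaret p.1 a) ∧ (∀ a ∈ A, HasExposedCaret p.2 a)) =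
        ((range n).filter fun a => HasExposedCaret p.1 a ∧ HasExposedCaret p.2 a).powerset := by
      ext A
      simp only [mem_filter, mem_powerset, subset_iff, mem_range]
      constructor
      · rintro ⟨h1, h2, h3⟩ a ha
        exact ⟨h1 ha, h2 a ha, h3 a ha⟩
      · intro h
        exact ⟨fun a ha => (h ha).1, fun a ha => (h ha).2.1, fun a ha => (h ha).2.2⟩
    rw [h2, sum_powerset_neg_one_pow_card]
    refine if_congr ?_ rfl rfl
    rw [filter_eq_empty_iff]
    constructor
    · intro h a _ ha
      exact h ⟨a, ha⟩
    · rintro h ⟨a, ha⟩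
      exact h (mem_range.2 (hp.1 ▸ ha.1.lt_numNodes)) ha
  rw [h1, sum_comm, signedCount]
  refine sum_congr rfl fun A _ => ?_
  have h2 : ((treesOfNumNodesEq n ×ˢ treesOfNumNodesEq n).filter fun p =>
      (∀ a ∈ A, HasExposedCaret p.1 a) ∧ (∀ a ∈ A, HasExposedCaret p.2 a)) =
      treesExposedOn n A ×ˢ treesExposedOn n A := by
    ext p
    simp only [mem_filter, mem_product, mem_treesOfNumNodesEq, mem_treesExposedOn]
    tauto
  rw [← sum_filter, sum_const, h2, card_product, nsmul_eq_mul, mul_comm, Nat.cast_mul, sq]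

/-! ### A growth bound from a differential equation -/

section Growth

open Polynomial

theorem coeff_one_sub_X_pow (k j : ℕ) :
    ((1 - X : ℤ[X]) ^ k).coeff j = (-1) ^ j * (k.choose j : ℤ) := by
  have h : (1 - X : ℤ[X]) ^ k = ((1 + X) ^ k).comp (-X) := by
    simp [sub_eq_add_neg]
  rw [h, show (-X : ℤ[X]) = C (-1) * X by simp, comp_C_mul_X_coeff, coeff_one_add_X_pow, mul_comm]

/-- The partial sums of `∑ (catalan m) ^ 2 * (X * (1 - X)) ^ m`. -/
def catalanSqPoly (N : ℕ) : ℤ[X] :=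
  ∑ m ∈ range N, C ((catalan m : ℤ) ^ 2) * (X * (1 - X)) ^ m

/-- The `m`-th term is a multiple of `X ^ m * (1 - X) ^ (m + 1)`; with `m = n - j` its coefficient
is the `j`-th term of `signedCount_eq_sum`. -/
theorem coeff_one_sub_X_mul_catalanSqPoly {n N : ℕ} (h : n < N) :
    ((1 - X) * catalanSqPoly N).coeff n = (numIrreducible n : ℤ) := by
  rw [numIrreducible_eq_signedCount, signedCount_eq_sum le_rfl, catalanSqPoly, mul_sum,
    finsetSum_coeff]
  have h1 : ∀ m, ((1 - X) * (C ((catalan m : ℤ) ^ 2) * (X * (1 - X)) ^ m)).coeff n =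
      if m ≤ n then (-1 : ℤ) ^ (n - m) * ((m + 1).choose (n - m) * (catalan m : ℤ) ^ 2) else 0 := by
    intro m
    rw [show (1 - X) * (C ((catalan m : ℤ) ^ 2) * (X * (1 - X)) ^ m) =
      C ((catalan m : ℤ) ^ 2) * (X ^ m * (1 - X) ^ (m + 1)) by rw [mul_pow]; ring,
      coeff_C_mul, coeff_X_pow_mul', coeff_one_sub_X_pow]
    split_ifs
    · ring
    · simp
  simp only [h1]
  rw [← sum_filter, show (range N).filter (· ≤ n) = range (n + 1) by ext; simp; omega,
    ← sum_range_reflect]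
  refine sum_congr rfl fun j hj => ?_
  have := mem_range.1 hj
  rw [show n + 1 - 1 - j = n - j by omega, show n - (n - j) = j by omega,
    show n - j + 1 = n + 1 - j by omega]

/-- Dividing by `1 - X` sums coefficients. -/
theorem coeff_catalanSqPoly {n N : ℕ} (h : n < N) :
    (catalanSqPoly N).coeff n = ∑ i ∈ range (n + 1), (numIrreducible i : ℤ) := by
  induction n with
  | zero =>
    have := coeff_one_sub_X_mul_catalanSqPoly h
    rw [sub_mul, one_mul, coeff_sub, coeff_X_mul_zero, sub_zero] at this
    simpa using this
  | succ n ih =>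
    have := coeff_one_sub_X_mul_catalanSqPoly h
    rw [sub_mul, one_mul, coeff_sub, coeff_X_mul, ih (by omega)] at this
    rw [sum_range_succ, ← this]
    ring

theorem catalan_sq_recurrence (n : ℕ) :
    ((n : ℤ) + 2) ^ 2 * (catalan (n + 1) : ℤ) ^ 2 = 4 * (2 * n + 1) ^ 2 * (catalan n : ℤ) ^ 2 := by
  have h1 := succ_mul_catalan_eq_centralBinom n
  have h2 := succ_mul_catalan_eq_centralBinom (n + 1)
  have h3 := Nat.succ_mul_centralBinom_succ n
  rw [← h1, ← h2] at h3
  have h4 : (n + 2) * catalan (n + 1) = 2 * (2 * n + 1) * catalan n := by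
    apply Nat.eq_of_mul_eq_mul_left (Nat.succ_pos n)
    rw [Nat.succ_eq_add_one]
    linarith
  have h5 : ((n : ℤ) + 2) * catalan (n + 1) = 2 * (2 * n + 1) * catalan n := by exact_mod_cast h4
  rw [← mul_pow, h5]
  ring

/-- The differential operator that annihilates the generating series of the pairs of trees without
common exposed carets, up to a polynomial. -/
def growthOperator (P : ℤ[X]) : ℤ[X] :=
  (1 - X) ^ 2 * (1 - 16 * (X * (1 - X))) * (1 - 2 * X) * (X ^ 2 * derivative (derivative P)) +
  (2 * X * (1 - X) ^ 2 * (1 - 16 * (X * (1 - X))) +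
    (1 - X) * (3 - 32 * (X * (1 - X))) * (1 - 2 * X) ^ 2) * (X * derivative P) +
  (1 - 2 * X) ^ 5 * P

theorem growthOperator_add (P Q : ℤ[X]) :
    growthOperator (P + Q) = growthOperator P + growthOperator Q := by
  simp only [growthOperator, derivative_add]
  ring

theorem growthOperator_C_mul (a : ℤ) (P : ℤ[X]) :
    growthOperator (C a * P) = C a * growthOperator P := by
  simp only [growthOperator, derivative_C_mul]
  ring

/-- With `z = X * (1 - X)` and `θ = z d/dz`, the operator is `(θ + 1)^2 - 4 z (2 θ + 1)^2` rewritten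
in `X`. The chain rule divides by `dz/dX = 1 - 2 * X`, and the factor `(1 - 2 * X) ^ 3` clears these
denominators. -/
theorem growthOperator_pow (m : ℕ) :
    growthOperator ((X * (1 - X)) ^ m) = (1 - 2 * X) ^ 3 *
      (C (((m : ℤ) + 1) ^ 2) * (X * (1 - X)) ^ m -
        C (4 * (2 * (m : ℤ) + 1) ^ 2) * (X * (1 - X)) ^ (m + 1)) := by
  have hZ : derivative (X * (1 - X) : ℤ[X]) = 1 - 2 * X := by
    simp; ring
  have h1 : derivative (1 - 2 * X : ℤ[X]) = -2 := by
    simp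
  rcases m with _ | _ | m
  · simp [growthOperator]
    ring
  · simp only [growthOperator, zero_add, pow_one, hZ, h1]
    simp
    ring
  · simp only [growthOperator, derivative_pow_succ, derivative_mul, hZ, h1, derivative_C]
    push_cast
    simp
    ring

/-- By `catalan_sq_recurrence` the contributions of consecutive powers telescope, leaving only the
two ends. -/
theorem growthOperator_catalanSqPoly (N : ℕ) :
    growthOperator (catalanSqPoly N) = (1 - 2 * X) ^ 3 *
      (1 - C (((N : ℤ) + 1) ^ 2 * (catalan N : ℤ) ^ 2) * (X * (1 - X)) ^ N) := by
  induction N with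
  | zero => simp [catalanSqPoly, growthOperator]
  | succ N ih =>
    have h := catalan_sq_recurrence N
    rw [catalanSqPoly, sum_range_succ, ← catalanSqPoly, growthOperator_add, ih,
      growthOperator_C_mul, growthOperator_pow]
    push_cast
    rw [show (N : ℤ) + 1 + 1 = N + 2 by ring, h]
    simp only [C_mul]
    ring

/-- A coefficient of `Q * Y` is `Q.coeff 0` times the same coefficient of `Y` plus a fixed linear
combination of earlier ones. This isolates the leading term of the recurrence. -/
theorem exists_abs_coeff_mul_sub_le (Q : ℤ[X]) :
    ∃ K : ℤ, ∀ (Y : ℤ[X]) (n : ℕ) (M : ℤ), 0 ≤ M → (∀ j < n, |Y.coeff j| ≤ M) →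
      |(Q * Y).coeff n - Q.coeff 0 * Y.coeff n| ≤ K * M := by
  induction Q using Polynomial.induction_on' with
  | add p q hp hq =>
    obtain ⟨K, hK⟩ := hp
    obtain ⟨L, hL⟩ := hq
    refine ⟨K + L, fun Y n M hM hY => ?_⟩
    rw [add_mul, coeff_add, coeff_add, add_mul, add_mul, add_sub_add_comm]
    exact (abs_add_le _ _).trans (add_le_add (hK Y n M hM hY) (hL Y n M hM hY))
  | monomial i a =>
    refine ⟨|a|, fun Y n M hM hY => ?_⟩
    rw [← C_mul_X_pow_eq_monomial, mul_assoc, coeff_C_mul, coeff_X_pow_mul', coeff_C_mul,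
      coeff_X_pow]
    have h0 : 0 ≤ |a| * M := mul_nonneg (abs_nonneg a) hM
    rcases Nat.eq_zero_or_pos i with rfl | hi
    · simpa using h0
    · rw [if_neg (by omega : ¬ 0 = i)]
      split_ifs with h
      · rw [mul_zero, zero_mul, sub_zero, abs_mul]
        exact mul_le_mul_of_nonneg_left (hY _ (by omega)) (abs_nonneg a)
      · simpa using h0

theorem exists_sum_numIrreducible_succ_le :
    ∃ C : ℕ, ∀ n, 3 ≤ n → ∑ i ∈ range (n + 2), numIrreducible i ≤
      C * ∑ i ∈ range (n + 1), numIrreducible i := by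
  obtain ⟨K₁, h₁⟩ := exists_abs_coeff_mul_sub_le
    ((1 - X) ^ 2 * (1 - 16 * (X * (1 - X))) * (1 - 2 * X))
  obtain ⟨K₂, h₂⟩ := exists_abs_coeff_mul_sub_le
    (2 * X * (1 - X) ^ 2 * (1 - 16 * (X * (1 - X))) +
      (1 - X) * (3 - 32 * (X * (1 - X))) * (1 - 2 * X) ^ 2)
  obtain ⟨K₃, h₃⟩ := exists_abs_coeff_mul_sub_le ((1 - 2 * X) ^ 5)
  refine ⟨(K₁ + K₂ + K₃).toNat, fun n hn => ?_⟩
  set g : ℕ → ℤ := fun n => ∑ i ∈ range (n + 1), (numIrreducible i : ℤ) with hg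
  have hmono : Monotone g := fun a b hab =>
    sum_le_sum_of_subset_of_nonneg (range_mono (by omega)) fun _ _ _ => by positivity
  have hg0 : ∀ n, 0 ≤ g n := fun n => by positivity
  set P := catalanSqPoly (n + 2)
  have hP : ∀ j, j ≤ n + 1 → P.coeff j = g j := fun j hj => coeff_catalanSqPoly (by omega)
  have hP1 : ∀ j, j ≤ n + 1 → (X * derivative P).coeff j = j * g j := by
    intro j hj
    rcases j with _ | j
    · simp
    · rw [coeff_X_mul, coeff_derivative, hP _ hj]
      push_cast
      ring
  have hP2 : ∀ j, j ≤ n + 1 → (X ^ 2 * derivative (derivative P)).coeff j = j * (j - 1) * g j := by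
    intro j hj
    rcases j with _ | _ | j
    · simp
    · rw [coeff_X_pow_mul']
      simp
    · rw [coeff_X_pow_mul, coeff_derivative, coeff_derivative, hP _ hj]
      push_cast
      ring
  have hM : 0 ≤ ((n : ℤ) + 1) ^ 2 * g n := mul_nonneg (by positivity) (hg0 n)
  have bound : ∀ (j : ℕ) (a : ℤ), j < n + 1 → 0 ≤ a → a ≤ ((n : ℤ) + 1) ^ 2 →
      |a * g j| ≤ ((n : ℤ) + 1) ^ 2 * g n := by
    intro j a hj h0 ha
    rw [abs_of_nonneg (mul_nonneg h0 (hg0 j))]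
    exact mul_le_mul ha (hmono (by omega)) (hg0 j) (by positivity)
  have b₁ := h₁ (X ^ 2 * derivative (derivative P)) (n + 1) _ hM (by
    intro j hj
    rw [hP2 j hj.le]
    have : (j : ℤ) ≤ n := by omega
    refine bound j _ hj ?_ (by nlinarith)
    rcases j with _ | j
    · simp
    · push_cast
      rw [add_sub_cancel_right]
      positivity)
  have b₂ := h₂ (X * derivative P) (n + 1) _ hM (by
    intro j hj
    rw [hP1 j hj.le]
    have : (j : ℤ) ≤ n := by omega
    exact bound j _ hj (by positivity) (by nlinarith))
  have b₃ := h₃ P (n + 1) _ hM (by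
    intro j hj
    rw [hP j hj.le, ← one_mul (g j)]
    exact bound j _ hj (by positivity) (by nlinarith))
  -- The right-hand side is `(1 - 2 * X) ^ 3` minus a multiple of `X ^ (n + 2)`; degree `n + 1`
  -- misses both because `3 ≤ n`.
  have key : (growthOperator P).coeff (n + 1) = 0 := by
    rw [growthOperator_catalanSqPoly, mul_sub, mul_one, mul_pow,
      show (1 - 2 * X : ℤ[X]) ^ 3 * (C ((((n + 2 : ℕ) : ℤ) + 1) ^ 2 * (catalan (n + 2) : ℤ) ^ 2) *
        (X ^ (n + 2) * (1 - X) ^ (n + 2))) = X ^ (n + 2) * ((1 - 2 * X) ^ 3 *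
        (C ((((n + 2 : ℕ) : ℤ) + 1) ^ 2 * (catalan (n + 2) : ℤ) ^ 2) * (1 - X) ^ (n + 2))) by ring,
      coeff_sub, coeff_X_pow_mul', if_neg (by omega), sub_zero]
    apply coeff_eq_zero_of_natDegree_lt
    have : ((1 - 2 * X : ℤ[X]) ^ 3).natDegree ≤ 3 := by compute_degree
    omega
  rw [growthOperator, coeff_add, coeff_add] at key
  rw [hP2 _ le_rfl] at b₁
  rw [hP1 _ le_rfl] at b₂
  rw [hP _ le_rfl] at b₃
  simp only [mul_coeff_zero, coeff_add, coeff_sub, coeff_X_zero, coeff_one_zero,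
    pow_succ, pow_zero, coeff_ofNat_zero] at b₁ b₂ b₃
  have c₁ := (abs_le.1 b₁).1
  have c₂ := (abs_le.1 b₂).1
  have c₃ := (abs_le.1 b₃).1
  push_cast at c₁ c₂ c₃
  -- The three coefficient polynomials have constant terms `1`, `3`, `1`, so `g (n + 1)` occurs with
  -- factor `(n + 1) * n + 3 * (n + 1) + 1 = (n + 2) ^ 2`, which is at least `(n + 1) ^ 2`.
  have main : ((n : ℤ) + 1) ^ 2 * g (n + 1) ≤ ((n : ℤ) + 1) ^ 2 * ((K₁ + K₂ + K₃) * g n) := by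
    have := hg0 (n + 1)
    simp only [pow_succ, pow_zero] at *
    nlinarith
  have main' : g (n + 1) ≤ (K₁ + K₂ + K₃) * g n := le_of_mul_le_mul_left main (by positivity)
  zify
  exact main'.trans (mul_le_mul_of_nonneg_right (Int.self_le_toNat _) (hg0 n))

end Growth

/-! ### Acting on the two halves of the unit interval -/

/-- The map `x ↦ 2 x` of `[0,1]`, cut off at `1`. -/
def stretchLeft (x : unitInterval) : unitInterval := Set.projIcc 0 1 zero_le_one (2 * (x : ℝ))

/-- The map `x ↦ 2 x - 1` of `[0,1]`, cut off at `0`. -/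
def stretchRight (x : unitInterval) : unitInterval :=
  Set.projIcc 0 1 zero_le_one (2 * (x : ℝ) - 1)

/-- The two stretches identify `[0,1]` with the path in the unit square that runs along `y = 0` and
then along `x = 1`; `mid` is the inverse. Order automorphisms fix the endpoints, so acting on each
coordinate preserves this path. -/
theorem stretch_cases (x : unitInterval) :
    (stretchLeft x : ℝ) = 2 * x ∧ stretchRight x = 0 ∨
      stretchLeft x = 1 ∧ (stretchRight x : ℝ) = 2 * x - 1 := by
  rcases le_total (x : ℝ) (1 / 2) with h | h
  · left
    constructor
    · rw [stretchLeft, Set.projIcc_of_mem _ ⟨by linarith [x.2.1], by linarith⟩]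
    · exact Set.projIcc_of_le_left _ (by linarith)
  · right
    constructor
    · exact Set.projIcc_of_right_le _ (by linarith)
    · rw [stretchRight, Set.projIcc_of_mem _ ⟨by linarith, by linarith [x.2.2]⟩]

theorem stretchLeft_mono : Monotone stretchLeft := fun x y h =>
  Set.monotone_projIcc _ (by have : (x : ℝ) ≤ y := h; linarith)

theorem stretchRight_mono : Monotone stretchRight := fun x y h =>
  Set.monotone_projIcc _ (by have : (x : ℝ) ≤ y := h; linarith)

/-- The midpoint of two points of `[0,1]`. -/
def mid (x y : unitInterval) : unitInterval :=
  ⟨((x : ℝ) + y) / 2, by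
    constructor
    · linarith [x.2.1, y.2.1]
    · linarith [x.2.2, y.2.2]⟩

theorem coe_mid (x y : unitInterval) : (mid x y : ℝ) = ((x : ℝ) + y) / 2 := rfl

theorem mid_stretch (x : unitInterval) : mid (stretchLeft x) (stretchRight x) = x := by
  apply Subtype.ext
  rw [coe_mid]
  rcases stretch_cases x with ⟨h1, h2⟩ | ⟨h1, h2⟩
  · rw [h1, h2]
    simp
  · rw [h1, h2]
    simp

theorem stretchLeft_mid {x y : unitInterval} (h : y = 0 ∨ x = 1) : stretchLeft (mid x y) = x := by
  rw [stretchLeft, coe_mid, mul_div_cancel₀ _ two_ne_zero]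
  rcases h with rfl | rfl
  · rw [Set.Icc.coe_zero, add_zero, Set.projIcc_val]
  · apply Set.projIcc_of_right_le
    have := y.2.1
    simp only [Set.Icc.coe_one]
    linarith

theorem stretchRight_mid {x y : unitInterval} (h : y = 0 ∨ x = 1) :
    stretchRight (mid x y) = y := by
  rw [stretchRight, coe_mid]
  rcases h with rfl | rfl
  · apply Set.projIcc_of_le_left
    have := x.2.2
    simp only [Set.Icc.coe_zero]
    linarith
  · have : 2 * (((1 : unitInterval) : ℝ) + y) / 2 - 1 = y := by
      simp
    rw [← mul_div_assoc, this, Set.projIcc_val]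

theorem map_stretch_cases (f g : unitInterval ≃o unitInterval) (x : unitInterval) :
    g (stretchRight x) = 0 ∨ f (stretchLeft x) = 1 := by
  rcases stretch_cases x with ⟨-, h⟩ | ⟨h, -⟩
  · left
    rw [h]
    exact map_bot g
  · right
    rw [h]
    exact map_top f

/-- The map acting as `f` on the left half of `[0,1]` and as `g` on the right half. -/
def sideBySide (f g : unitInterval ≃o unitInterval) (x : unitInterval) : unitInterval :=
  mid (f (stretchLeft x)) (g (stretchRight x))

theorem stretchLeft_sideBySide (f g : unitInterval ≃o unitInterval) (x : unitInterval) :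
    stretchLeft (sideBySide f g x) = f (stretchLeft x) :=
  stretchLeft_mid (map_stretch_cases f g x)

theorem stretchRight_sideBySide (f g : unitInterval ≃o unitInterval) (x : unitInterval) :
    stretchRight (sideBySide f g x) = g (stretchRight x) :=
  stretchRight_mid (map_stretch_cases f g x)

theorem sideBySide_sideBySide (f g f' g' : unitInterval ≃o unitInterval) (x : unitInterval) :
    sideBySide f g (sideBySide f' g' x) = sideBySide (f * f') (g * g') x := by
  rw [sideBySide, stretchLeft_sideBySide, stretchRight_sideBySide]
  rfl

theorem sideBySide_one (x : unitInterval) : sideBySide 1 1 x = x := mid_stretch x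

theorem sideBySide_mono (f g : unitInterval ≃o unitInterval) : Monotone (sideBySide f g) := by
  intro x y h
  have h1 : (f (stretchLeft x) : ℝ) ≤ f (stretchLeft y) := f.monotone (stretchLeft_mono h)
  have h2 : (g (stretchRight x) : ℝ) ≤ g (stretchRight y) := g.monotone (stretchRight_mono h)
  rw [← Subtype.coe_le_coe, sideBySide, sideBySide, coe_mid, coe_mid]
  linarith

/-- `sideBySide` as a homomorphism. -/
def sideBySideHom :
    (unitInterval ≃o unitInterval) × (unitInterval ≃o unitInterval) →*
      (unitInterval ≃o unitInterval) where
  toFun p :=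
    { toFun := sideBySide p.1 p.2
      invFun := sideBySide p.1⁻¹ p.2⁻¹
      left_inv := fun x => by
        rw [sideBySide_sideBySide, inv_mul_cancel, inv_mul_cancel, sideBySide_one]
      right_inv := fun x => by
        rw [sideBySide_sideBySide, mul_inv_cancel, mul_inv_cancel, sideBySide_one]
      map_rel_iff' := by
        intro x y
        refine ⟨fun h => ?_, fun h => sideBySide_mono _ _ h⟩
        have := sideBySide_mono p.1⁻¹ p.2⁻¹ h
        simpa only [Equiv.coe_fn_mk, sideBySide_sideBySide, inv_mul_cancel, sideBySide_one]
          using this }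
  map_one' := by
    ext x
    exact congrArg _ (sideBySide_one x)
  map_mul' p q := by
    ext x
    exact congrArg _ (sideBySide_sideBySide p.1 p.2 q.1 q.2 x).symm

theorem sideBySideHom_apply (p : (unitInterval ≃o unitInterval) × (unitInterval ≃o unitInterval))
    (x : unitInterval) : sideBySideHom p x = sideBySide p.1 p.2 x := rfl

theorem sideBySideHom_injective : Function.Injective sideBySideHom := by
  rintro ⟨f, g⟩ ⟨f', g'⟩ h
  have hx : ∀ x, sideBySide f g x = sideBySide f' g' x := fun x => congrArg (· x) h
  refine Prod.ext (RelIso.ext fun x => ?_) (RelIso.ext fun x => ?_)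
  · have := congrArg stretchLeft (hx (mid x 0))
    rwa [stretchLeft_sideBySide, stretchLeft_sideBySide, stretchLeft_mid (Or.inl rfl)] at this
  · have := congrArg stretchRight (hx (mid 1 x))
    rwa [stretchRight_sideBySide, stretchRight_sideBySide, stretchRight_mid (Or.inr rfl)] at this

/-! ### Placing tree pairs under a common root -/

/-- The tree pair whose left and right subtrees are given by two tree pairs. -/
def TreePair.join (p q : TreePair) : TreePair where
  domainTree := .node () p.domainTree q.domainTree
  rangeTree := .node () p.rangeTree q.rangeTree
  numNodes_eq := by simp only [numNodes, p.numNodes_eq, q.numNodes_eq]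

/-- The tree pair of size zero. -/
def TreePair.trivial : TreePair := ⟨.nil, .nil, rfl⟩

theorem TreePair.toOrderIso_leafIso (p : TreePair) {x : unitInterval} {u : ℝ}
    (h : leafMap p.domainTree u = x) : (p.toOrderIso x : ℝ) = leafMap p.rangeTree u := by
  change leafIso p.rangeTree ((leafIso p.domainTree).symm x) = _
  rw [← h, ← leafIso_apply, OrderIso.symm_apply_apply, leafIso_apply]

theorem TreePair.toOrderIso_of_eq (p : TreePair) (h : p.domainTree = p.rangeTree) :
    p.toOrderIso = 1 := by
  refine RelIso.ext fun x => Subtype.ext ?_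
  obtain ⟨u, hu⟩ := leafMap_surjective p.domainTree x
  rw [p.toOrderIso_leafIso hu, ← h, hu]
  rfl

/-- Compare both sides in the leaf coordinate of the subtree that contains the point; for the right
subtree it is shifted by the number of leaves on the left. -/
theorem TreePair.toOrderIso_join (p q : TreePair) :
    (p.join q).toOrderIso = sideBySideHom (p.toOrderIso, q.toOrderIso) := by
  refine RelIso.ext fun x => Subtype.ext ?_
  rw [sideBySideHom_apply, sideBySide, coe_mid]
  have hn := p.numLeaves_eq
  rcases stretch_cases x with ⟨h1, h2⟩ | ⟨h1, h2⟩
  · obtain ⟨u, hu⟩ := leafMap_surjective p.domainTree (stretchLeft x)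
    have hle : u ≤ p.domainTree.numLeaves := by
      rw [← (leafMap_strictMono p.domainTree).le_iff_le, leafMap_numLeaves, hu]
      exact (stretchLeft x).2.2
    have e : leafMap (p.join q).domainTree u = x := by
      simp only [TreePair.join, leafMap, if_pos hle, hu, h1]
      ring
    rw [(p.join q).toOrderIso_leafIso e, p.toOrderIso_leafIso hu, h2,
      show q.toOrderIso 0 = 0 from map_bot q.toOrderIso]
    rw [hn] at hle
    simp [TreePair.join, leafMap, if_pos hle]
  · obtain ⟨u, hu⟩ := leafMap_surjective q.domainTree (stretchRight x)
    have hle : 0 ≤ u := by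
      rw [← (leafMap_strictMono q.domainTree).le_iff_le, leafMap_zero, hu]
      exact (stretchRight x).2.1
    have node : ∀ l r : BinaryTree Unit,
        leafMap (.node () l r) (u + l.numLeaves) = 1 / 2 + leafMap r u / 2 := by
      intro l r
      simp only [leafMap]
      split_ifs with h
      -- At the common boundary `leafMap` uses its left branch, and both branches give `1 / 2`.
      · obtain rfl : u = 0 := by linarith
        rw [zero_add, leafMap_numLeaves, leafMap_zero]
        norm_num
      · rw [add_sub_cancel_right]
    have e : leafMap (p.join q).domainTree (u + p.domainTree.numLeaves) = x := by
      simp only [TreePair.join, node, hu, h2]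
      ring
    rw [(p.join q).toOrderIso_leafIso e, q.toOrderIso_leafIso hu, h1,
      show p.toOrderIso 1 = 1 from map_top p.toOrderIso, hn]
    simp only [TreePair.join, node, Set.Icc.coe_one]
    ring

theorem TreePair.join_inj {p q p' q' : TreePair} (h : p.join q = p'.join q') :
    (p.domainTree = p'.domainTree ∧ p.rangeTree = p'.rangeTree) ∧
      (q.domainTree = q'.domainTree ∧ q.rangeTree = q'.rangeTree) := by
  have h1 := congrArg domainTree h
  have h2 := congrArg rangeTree h
  simp only [join, node.injEq, true_and] at h1 h2
  exact ⟨⟨h1.1, h2.1⟩, ⟨h1.2, h2.2⟩⟩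

theorem TreePair.eq_of_size_eq_one {p : TreePair} (h : p.size = 1) :
    p.domainTree = .node () .nil .nil ∧ p.rangeTree = .node () .nil .nil := by
  have aux : ∀ t : BinaryTree Unit, t.numNodes = 1 → t = .node () .nil .nil := by
    intro t ht
    rcases t with _ | ⟨_, _ | _, _ | _⟩ <;> simp [numNodes] at ht ⊢
  exact ⟨aux _ h, aux _ (p.numNodes_eq ▸ h)⟩

theorem ReducedTreePair.ext_trees {p q : ReducedTreePair}
    (h1 : p.1.domainTree = q.1.domainTree) (h2 : p.1.rangeTree = q.1.rangeTree) : p = q := by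
  obtain ⟨⟨_, _, _⟩, _⟩ := p
  obtain ⟨⟨_, _, _⟩, _⟩ := q
  simp only at h1 h2
  subst h1 h2
  rfl

theorem ne_nil_of_two_le {t : BinaryTree Unit} (h : 2 ≤ t.numNodes) : t ≠ .nil := by
  rintro rfl
  simp [numNodes] at h

/-- The old trees are not single leaves, so the new root is not an exposed caret and no new common
exposed caret arises. -/
theorem TreePair.IsReduced.join_trivial {p : TreePair} (hp : p.IsReduced) (h : 2 ≤ p.size) :
    (p.join .trivial).IsReduced := by
  refine ⟨by simp [TreePair.size, TreePair.join, numNodes], fun _ => ?_⟩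
  rintro ⟨i, h1, h2⟩
  have hd : p.domainTree ≠ .nil := ne_nil_of_two_le h
  have hr : p.rangeTree ≠ .nil := ne_nil_of_two_le (p.numNodes_eq ▸ h)
  simp only [TreePair.join, TreePair.trivial, HasExposedCaret, hd, hr, false_and, exists_false,
    or_false, false_or] at h1 h2
  exact hp.2 h ⟨i, h1, h2⟩

theorem TreePair.IsReduced.trivial_join {p : TreePair} (hp : p.IsReduced) (h : 2 ≤ p.size) :
    (TreePair.trivial.join p).IsReduced := by
  refine ⟨by simp [TreePair.size, TreePair.join, numNodes], fun _ => ?_⟩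
  rintro ⟨i, h1, h2⟩
  have hd : p.domainTree ≠ .nil := ne_nil_of_two_le h
  have hr : p.rangeTree ≠ .nil := ne_nil_of_two_le (p.numNodes_eq ▸ h)
  simp only [TreePair.join, TreePair.trivial, HasExposedCaret, hd, hr, false_and, and_false,
    false_or] at h1 h2
  obtain ⟨j, h1, rfl⟩ := h1
  obtain ⟨m, h2, h3⟩ := h2
  obtain rfl := Nat.add_left_cancel h3
  exact hp.2 h ⟨j, h1, h2⟩

theorem TreePair.size_join_trivial (p : TreePair) : (p.join .trivial).size = p.size + 1 := by
  simp [TreePair.size, TreePair.join, TreePair.trivial, numNodes]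

theorem TreePair.size_trivial_join (p : TreePair) : (TreePair.trivial.join p).size = p.size + 1 := by
  simp [TreePair.size, TreePair.join, TreePair.trivial, numNodes]

theorem ReducedTreePair.two_le_size {p : ReducedTreePair} (h : p.1.size ≠ 1) : 2 ≤ p.1.size := by
  have := p.2.1
  omega

/-- The reduced tree pair of the element that acts on the left half of `[0,1]` as `p` does on
`[0,1]`, and trivially on the right half. -/
def ReducedTreePair.left (p : ReducedTreePair) : ReducedTreePair :=
  -- A pair of size one represents the identity, and hanging it below a root would create a common
  -- exposed caret, so it is kept.
  if h : p.1.size = 1 then p else ⟨p.1.join .trivial, p.2.join_trivial (two_le_size h)⟩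

/-- The reduced tree pair of the element that acts on the right half of `[0,1]` as `p` does on
`[0,1]`, and trivially on the left half. -/
def ReducedTreePair.right (p : ReducedTreePair) : ReducedTreePair :=
  if h : p.1.size = 1 then p else ⟨TreePair.trivial.join p.1, p.2.trivial_join (two_le_size h)⟩

theorem ReducedTreePair.left_of_size_eq {p : ReducedTreePair} (h : p.1.size = 1) : p.left = p :=
  dif_pos h

theorem ReducedTreePair.coe_left_of_size_ne {p : ReducedTreePair} (h : p.1.size ≠ 1) :
    p.left.1 = p.1.join .trivial :=
  congrArg Subtype.val (dif_neg h)

theorem ReducedTreePair.toOrderIso_left (p : ReducedTreePair) :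
    p.left.1.toOrderIso = sideBySideHom (p.1.toOrderIso, 1) := by
  by_cases h : p.1.size = 1
  · have := TreePair.eq_of_size_eq_one h
    rw [left_of_size_eq h, p.1.toOrderIso_of_eq (this.1.trans this.2.symm)]
    exact (map_one sideBySideHom).symm
  · rw [coe_left_of_size_ne h, TreePair.toOrderIso_join, TreePair.trivial.toOrderIso_of_eq rfl]

theorem ReducedTreePair.size_left (p : ReducedTreePair) :
    p.left.1.size = if p.1.size = 1 then 1 else p.1.size + 1 := by
  split_ifs with h
  · rw [left_of_size_eq h, h]
  · rw [coe_left_of_size_ne h, TreePair.size_join_trivial]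

theorem ReducedTreePair.left_injective : Function.Injective left := by
  intro p q h
  have hs := congrArg (fun p => p.1.size) h
  simp only [size_left] at hs
  have hp := p.2.1
  have hq := q.2.1
  by_cases h1 : p.1.size = 1 <;> by_cases h2 : q.1.size = 1
  · rwa [left_of_size_eq h1, left_of_size_eq h2] at h
  · rw [if_pos h1, if_neg h2] at hs; omega
  · rw [if_neg h1, if_pos h2] at hs; omega
  · have h := congrArg Subtype.val h
    rw [coe_left_of_size_ne h1, coe_left_of_size_ne h2] at h
    exact ext_trees (TreePair.join_inj h).1.1 (TreePair.join_inj h).1.2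

theorem ReducedTreePair.right_of_size_eq {p : ReducedTreePair} (h : p.1.size = 1) : p.right = p :=
  dif_pos h

theorem ReducedTreePair.coe_right_of_size_ne {p : ReducedTreePair} (h : p.1.size ≠ 1) :
    p.right.1 = TreePair.trivial.join p.1 :=
  congrArg Subtype.val (dif_neg h)

theorem ReducedTreePair.toOrderIso_right (p : ReducedTreePair) :
    p.right.1.toOrderIso = sideBySideHom (1, p.1.toOrderIso) := by
  by_cases h : p.1.size = 1
  · have := TreePair.eq_of_size_eq_one h
    rw [right_of_size_eq h, p.1.toOrderIso_of_eq (this.1.trans this.2.symm)]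
    exact (map_one sideBySideHom).symm
  · rw [coe_right_of_size_ne h, TreePair.toOrderIso_join, TreePair.trivial.toOrderIso_of_eq rfl]

theorem ReducedTreePair.size_right (p : ReducedTreePair) :
    p.right.1.size = if p.1.size = 1 then 1 else p.1.size + 1 := by
  split_ifs with h
  · rw [right_of_size_eq h, h]
  · rw [coe_right_of_size_ne h, TreePair.size_trivial_join]

theorem ReducedTreePair.right_injective : Function.Injective right := by
  intro p q h
  have hs := congrArg (fun p => p.1.size) h
  simp only [size_right] at hs
  have hp := p.2.1
  have hq := q.2.1
  by_cases h1 : p.1.size = 1 <;> by_cases h2 : q.1.size = 1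
  · rwa [right_of_size_eq h1, right_of_size_eq h2] at h
  · rw [if_pos h1, if_neg h2] at hs; omega
  · rw [if_neg h1, if_pos h2] at hs; omega
  · have h := congrArg Subtype.val h
    rw [coe_right_of_size_ne h1, coe_right_of_size_ne h2] at h
    exact ext_trees (TreePair.join_inj h).2.1 (TreePair.join_inj h).2.2

theorem ReducedTreePair.left_ne_right {p q : ReducedTreePair} (hp : p.1.size ≠ 1) :
    p.left ≠ q.right := by
  intro h
  have hs := congrArg (fun p => p.1.size) h
  simp only [size_left, size_right, if_neg hp] at hs
  have h1 := two_le_size hp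
  split_ifs at hs with hq
  · omega
  · have h := congrArg Subtype.val h
    rw [coe_left_of_size_ne hp, coe_right_of_size_ne hq] at h
    exact ne_nil_of_two_le h1 (TreePair.join_inj h).1.1

/-! ### Generating direct products -/

/-- The tuple generating the direct product of the subgroups generated by `t` and `u`. -/
def joinTuples {k l : ℕ} (t : Sym ReducedTreePair k) (u : Sym ReducedTreePair l) :
    Sym ReducedTreePair (k + l) :=
  (t.map ReducedTreePair.left).append (u.map ReducedTreePair.right)

/-- The generated subgroup, seen inside the group of all order automorphisms of `[0,1]`. -/
def orderIsoSubgroup {k : ℕ} (t : Sym ReducedTreePair k) :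
    Subgroup (unitInterval ≃o unitInterval) :=
  Subgroup.closure {f | ∃ p ∈ t, p.1.toOrderIso = f}

/-- Passing to the ambient group of order automorphisms does not change the subgroup. -/
def generatedSubgroupEquiv {k : ℕ} (t : Sym ReducedTreePair k) :
    generatedSubgroup t ≃* orderIsoSubgroup t :=
  ((generatedSubgroup t).equivMapOfInjective F.subtype F.subtype_injective).trans
    (MulEquiv.subgroupCongr (by
      rw [generatedSubgroup, orderIsoSubgroup, MonoidHom.map_closure]
      congr 1
      ext f
      constructor
      · rintro ⟨_, ⟨p, hp, rfl⟩, rfl⟩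
        exact ⟨p, hp, rfl⟩
      · rintro ⟨p, hp, rfl⟩
        exact ⟨_, ⟨p, hp, rfl⟩, rfl⟩))

/-- Each generator lies in one factor, and the factors separately lie in the generated subgroup,
since `(f, g) = (f, 1) * (1, g)`. -/
theorem orderIsoSubgroup_joinTuples {k l : ℕ} (t : Sym ReducedTreePair k)
    (u : Sym ReducedTreePair l) :
    orderIsoSubgroup (joinTuples t u) =
      ((orderIsoSubgroup t).prod (orderIsoSubgroup u)).map sideBySideHom := by
  apply le_antisymm
  · rw [orderIsoSubgroup, Subgroup.closure_le]
    rintro _ ⟨p, hp, rfl⟩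
    rw [joinTuples, Sym.mem_append_iff, Sym.mem_map, Sym.mem_map] at hp
    rcases hp with ⟨q, hq, rfl⟩ | ⟨q, hq, rfl⟩
    · exact ⟨(q.1.toOrderIso, 1), ⟨Subgroup.subset_closure ⟨q, hq, rfl⟩, one_mem _⟩,
        q.toOrderIso_left.symm⟩
    · exact ⟨(1, q.1.toOrderIso), ⟨one_mem _, Subgroup.subset_closure ⟨q, hq, rfl⟩⟩,
        q.toOrderIso_right.symm⟩
  · have h1 : orderIsoSubgroup t ≤ (orderIsoSubgroup (joinTuples t u)).comap
        (sideBySideHom.comp (MonoidHom.inl _ _)) := by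
      rw [orderIsoSubgroup, Subgroup.closure_le]
      rintro _ ⟨q, hq, rfl⟩
      refine Subgroup.subset_closure ⟨q.left, ?_, q.toOrderIso_left⟩
      rw [joinTuples, Sym.mem_append_iff]
      exact Or.inl (Sym.mem_map.2 ⟨q, hq, rfl⟩)
    have h2 : orderIsoSubgroup u ≤ (orderIsoSubgroup (joinTuples t u)).comap
        (sideBySideHom.comp (MonoidHom.inr _ _)) := by
      rw [orderIsoSubgroup, Subgroup.closure_le]
      rintro _ ⟨q, hq, rfl⟩
      refine Subgroup.subset_closure ⟨q.right, ?_, q.toOrderIso_right⟩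
      rw [joinTuples, Sym.mem_append_iff]
      exact Or.inr (Sym.mem_map.2 ⟨q, hq, rfl⟩)
    rintro _ ⟨⟨f, g⟩, ⟨hf, hg⟩, rfl⟩
    have : ((f, g) : (unitInterval ≃o unitInterval) × (unitInterval ≃o unitInterval)) =
        (f, 1) * (1, g) := by simp
    rw [this, map_mul]
    exact mul_mem (h1 hf) (h2 hg)

theorem joinTuples_mem_generatingTuples {H K : Type*} [Group H] [Group K] {k l : ℕ}
    {t : Sym ReducedTreePair k} {u : Sym ReducedTreePair l} (ht : t ∈ generatingTuples k H)
    (hu : u ∈ generatingTuples l K) : joinTuples t u ∈ generatingTuples (k + l) (H × K) := by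
  obtain ⟨e⟩ := ht
  obtain ⟨e'⟩ := hu
  refine ⟨(generatedSubgroupEquiv _).trans ((MulEquiv.subgroupCongr
    (orderIsoSubgroup_joinTuples t u)).trans
    ((Subgroup.equivMapOfInjective _ _ sideBySideHom_injective).symm.trans
    ((Subgroup.prodEquiv _ _).trans (MulEquiv.prodCongr ?_ ?_))))⟩
  · exact (generatedSubgroupEquiv t).symm.trans e
  · exact (generatedSubgroupEquiv u).symm.trans e'

theorem joinTuples_mem_sphMax {k l n : ℕ} (hn : 2 ≤ n)
    {t : Sym ReducedTreePair k} {u : Sym ReducedTreePair l} (ht : t ∈ sphMax k n)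
    (hu : u ∈ sphMax l n) : joinTuples t u ∈ sphMax (k + l) (n + 1) := by
  constructor
  · intro p hp
    rw [joinTuples, Sym.mem_append_iff, Sym.mem_map, Sym.mem_map] at hp
    rcases hp with ⟨q, hq, rfl⟩ | ⟨q, hq, rfl⟩
    · have := ht.1 q hq
      rw [q.size_left]
      split_ifs <;> omega
    · have := hu.1 q hq
      rw [q.size_right]
      split_ifs <;> omega
  · obtain ⟨q, hq, hqn⟩ := ht.2
    refine ⟨q.left, ?_, ?_⟩
    · rw [joinTuples, Sym.mem_append_iff]
      exact Or.inl (Sym.mem_map.2 ⟨q, hq, rfl⟩)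
    · rw [q.size_left, if_neg (by omega), hqn]

/-! ### The number of reduced tree pairs -/

/-- The reduced tree pairs of size `n`. -/
def reducedOfSize (n : ℕ) : Set ReducedTreePair := {p | p.1.size = n}

/-- The reduced tree pairs of size at most `n`. -/
def reducedUpTo (n : ℕ) : Set ReducedTreePair := {p | p.1.size ≤ n}

theorem reducedUpTo_finite (n : ℕ) : (reducedUpTo n).Finite := by
  classical
  let U : Finset (BinaryTree Unit) := (range (n + 1)).biUnion treesOfNumNodesEq
  have hinj : Function.Injective
      (fun p : ReducedTreePair => (p.1.domainTree, p.1.rangeTree)) := fun p q h =>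
    ReducedTreePair.ext_trees (congrArg Prod.fst h) (congrArg Prod.snd h)
  refine Set.Finite.of_finite_image (f := fun p : ReducedTreePair =>
    (p.1.domainTree, p.1.rangeTree)) ((U ×ˢ U).finite_toSet.subset ?_) hinj.injOn
  rintro _ ⟨p, hp, rfl⟩
  have hp : p.1.domainTree.numNodes ≤ n := hp
  have hp' := hp
  rw [p.1.numNodes_eq] at hp'
  simp [U, hp, hp']

theorem reducedOfSize_subset (n : ℕ) : reducedOfSize n ⊆ reducedUpTo n := fun _ h => le_of_eq h

theorem reducedOfSize_finite (n : ℕ) : (reducedOfSize n).Finite :=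
  (reducedUpTo_finite n).subset (reducedOfSize_subset n)

/-- The counts differ in sizes zero and one: the empty pair is irreducible but not reduced, the pair
of single carets is reduced but not irreducible. -/
theorem ncard_reducedOfSize {n : ℕ} (hn : 2 ≤ n) :
    (reducedOfSize n).ncard = numIrreducible n := by
  classical
  have hinj : Function.Injective
      (fun p : ReducedTreePair => (p.1.domainTree, p.1.rangeTree)) := fun p q h =>
    ReducedTreePair.ext_trees (congrArg Prod.fst h) (congrArg Prod.snd h)
  rw [← Set.ncard_image_of_injective _ hinj, numIrreducible, ← Set.ncard_coe_finset]
  congr 1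
  ext ⟨S, T⟩
  simp only [Set.mem_image, mem_coe, mem_filter, mem_product, mem_treesOfNumNodesEq,
    Prod.mk.injEq]
  constructor
  · rintro ⟨p, hp, rfl, rfl⟩
    have hp : p.1.size = n := hp
    exact ⟨⟨hp, p.1.numNodes_eq ▸ hp⟩, p.2.2 (by omega)⟩
  · rintro ⟨⟨hS, hT⟩, h⟩
    exact ⟨⟨⟨S, T, hS.trans hT.symm⟩, by simp only [TreePair.size]; omega, fun _ => h⟩,
      hS, rfl, rfl⟩

/-- Left and right placement are injections with disjoint images. -/
theorem two_mul_ncard_reducedOfSize_le {n : ℕ} (hn : 2 ≤ n) :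
    2 * (reducedOfSize n).ncard ≤ (reducedOfSize (n + 1)).ncard := by
  rw [two_mul]
  nth_rw 1 [← Set.ncard_image_of_injective (reducedOfSize n) ReducedTreePair.left_injective]
  rw [← Set.ncard_image_of_injective (reducedOfSize n) ReducedTreePair.right_injective,
    ← Set.ncard_union_eq _ ((reducedOfSize_finite n).image _) ((reducedOfSize_finite n).image _)]
  · refine Set.ncard_le_ncard ?_ (reducedOfSize_finite _)
    have aux : ∀ p ∈ reducedOfSize n, (if p.1.size = 1 then 1 else p.1.size + 1) = n + 1 := by
      intro p hp
      have hp : p.1.size = n := hp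
      rw [if_neg (by omega), hp]
    rintro _ (⟨p, hp, rfl⟩ | ⟨p, hp, rfl⟩)
    · exact p.size_left.trans (aux p hp)
    · exact p.size_right.trans (aux p hp)
  · rw [Set.disjoint_left]
    rintro _ ⟨p, hp, rfl⟩ ⟨q, hq, h⟩
    have hp : p.1.size = n := hp
    exact ReducedTreePair.left_ne_right (by omega) h.symm

theorem numIrreducible_zero : numIrreducible 0 = 1 := by
  have := numIrreducible_eq_signedCount 0
  rw [signedCount_eq_sum le_rfl] at this
  simp at this
  exact_mod_cast this

theorem numIrreducible_one : numIrreducible 1 = 0 := by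
  have := numIrreducible_eq_signedCount 1
  rw [signedCount_eq_sum le_rfl] at this
  simp [sum_range_succ] at this
  exact_mod_cast this

theorem numIrreducible_two : numIrreducible 2 = 2 := by
  have := numIrreducible_eq_signedCount 2
  rw [signedCount_eq_sum le_rfl] at this
  simp [sum_range_succ, catalan_two] at this
  exact_mod_cast this

/-- The terms at least double from `n = 2` on; the base case is `1 + 0 + 2 ≤ 2 * 2`. -/
theorem sum_numIrreducible_le {n : ℕ} (hn : 2 ≤ n) :
    ∑ i ∈ range (n + 1), numIrreducible i ≤ 2 * numIrreducible n := by
  induction n, hn using Nat.le_induction with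
  | base => simp [sum_range_succ, numIrreducible_zero, numIrreducible_one, numIrreducible_two]
  | succ n hn ih =>
    have := two_mul_ncard_reducedOfSize_le hn
    rw [ncard_reducedOfSize hn, ncard_reducedOfSize (by omega)] at this
    rw [sum_range_succ]
    omega

theorem ncard_reducedUpTo_le {n : ℕ} (hn : 1 ≤ n) :
    (reducedUpTo n).ncard ≤ ∑ i ∈ range (n + 1), numIrreducible i := by
  induction n, hn using Nat.le_induction with
  | base =>
    simp only [sum_range_succ, range_zero, sum_empty, numIrreducible_zero, numIrreducible_one]
    -- The single reduced pair of size one is matched with the irreducible empty pair.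
    rw [zero_add, add_zero, Set.ncard_le_one (reducedUpTo_finite 1)]
    intro p hp q hq
    have hp' := TreePair.eq_of_size_eq_one (le_antisymm hp p.2.1)
    have hq' := TreePair.eq_of_size_eq_one (le_antisymm hq q.2.1)
    exact ReducedTreePair.ext_trees (hp'.1.trans hq'.1.symm) (hp'.2.trans hq'.2.symm)
  | succ n hn ih =>
    have : reducedUpTo (n + 1) = reducedUpTo n ∪ reducedOfSize (n + 1) := by
      ext p
      simp only [reducedUpTo, reducedOfSize, Set.mem_union, Set.mem_ofPred_eq]
      omega
    rw [this, sum_range_succ, ← ncard_reducedOfSize (n := n + 1) (by omega)]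
    exact (Set.ncard_union_le _ _).trans (Nat.add_le_add_right ih _)

theorem exists_ncard_reducedUpTo_succ_le :
    ∃ C : ℕ, ∀ n, 3 ≤ n → (reducedUpTo (n + 1)).ncard ≤ C * (reducedOfSize n).ncard := by
  obtain ⟨C, hC⟩ := exists_sum_numIrreducible_succ_le
  refine ⟨C * 2, fun n hn => (ncard_reducedUpTo_le (by omega)).trans ((hC n hn).trans ?_)⟩
  rw [ncard_reducedOfSize (by omega), mul_assoc]
  exact Nat.mul_le_mul_left _ (sum_numIrreducible_le (by omega))

/-! ### The size of the spheres -/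

/-- Multisets whose components all have size exactly `n` already lie in the sphere, and each has at
most `k!` orderings. For `k = 0` the sphere is empty and the bound fails. -/
theorem pow_ncard_reducedOfSize_le {k : ℕ} (hk : 1 ≤ k) (n : ℕ) :
    (reducedOfSize n).ncard ^ k ≤ k.factorial * (sphMax k n).ncard := by
  classical
  have : Finite (reducedOfSize n) := reducedOfSize_finite n
  have := Fintype.ofFinite (reducedOfSize n)
  have h1 : Fintype.card (Sym (reducedOfSize n) k) ≤ (sphMax k n).ncard := by
    rw [← Nat.card_eq_fintype_card, ← Set.ncard_univ, ← Set.ncard_image_of_injective _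
      (Sym.map_injective Subtype.val_injective k)]
    refine Set.ncard_le_ncard ?_ (sphMax_finite k n)
    rintro _ ⟨s, -, rfl⟩
    constructor
    · intro p hp
      obtain ⟨q, -, rfl⟩ := Sym.mem_map.1 hp
      exact le_of_eq q.2
    · obtain ⟨k, rfl⟩ : ∃ m, k = m + 1 := ⟨k - 1, by omega⟩
      obtain ⟨q, hq⟩ := s.exists_mem
      exact ⟨q, Sym.mem_map.2 ⟨q, hq, rfl⟩, q.2⟩
  rw [Sym.card_sym_eq_multichoose, Nat.multichoose_eq] at h1
  refine le_trans ?_ (Nat.mul_le_mul_left _ h1)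
  rw [← Nat.ascFactorial_eq_factorial_mul_choose', ← Nat.card_eq_fintype_card]
  exact Nat.pow_succ_le_ascFactorial _ _

theorem ncard_sphMax_le (k n : ℕ) : (sphMax k n).ncard ≤ (reducedUpTo n).ncard ^ k := by
  classical
  have : Finite (reducedUpTo n) := reducedUpTo_finite n
  have := Fintype.ofFinite (reducedUpTo n)
  let f : List.Vector (reducedUpTo n) k → Sym ReducedTreePair k := fun v =>
    (Sym.ofVector v).map Subtype.val
  have hf : sphMax k n ⊆ f '' Set.univ := by
    intro t ht
    obtain ⟨⟨s⟩, hs⟩ : ∃ s : Sym (reducedUpTo n) k, s.map Subtype.val = t := by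
      refine ⟨t.attach.map fun p => ⟨p.1, ht.1 p.1 p.2⟩, ?_⟩
      rw [Sym.map_map]
      exact t.attach_map_coe
    induction s using Quotient.inductionOn with
    | _ s => exact ⟨⟨s, by assumption⟩, Set.mem_univ _, hs⟩
  refine (Set.ncard_le_ncard hf (Set.toFinite _)).trans ((Set.ncard_image_le).trans ?_)
  rw [Set.ncard_univ, Nat.card_eq_fintype_card, card_vector, ← Nat.card_eq_fintype_card]
  rfl

theorem exists_ncard_sphMax_add_le {k l : ℕ} (hk : 1 ≤ k) (hl : 1 ≤ l) :
    ∃ D : ℕ, ∀ n, 3 ≤ n →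
      (sphMax (k + l) (n + 1)).ncard ≤ D * ((sphMax k n).ncard * (sphMax l n).ncard) := by
  obtain ⟨C, hC⟩ := exists_ncard_reducedUpTo_succ_le
  refine ⟨C ^ (k + l) * (k.factorial * l.factorial), fun n hn => ?_⟩
  calc (sphMax (k + l) (n + 1)).ncard ≤ (C * (reducedOfSize n).ncard) ^ (k + l) :=
        (ncard_sphMax_le _ _).trans (Nat.pow_le_pow_left (hC n hn) _)
    _ = C ^ (k + l) * ((reducedOfSize n).ncard ^ k * (reducedOfSize n).ncard ^ l) := by
        rw [mul_pow, ← pow_add]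
    _ ≤ C ^ (k + l) * ((k.factorial * (sphMax k n).ncard) *
          (l.factorial * (sphMax l n).ncard)) :=
        Nat.mul_le_mul_left _ (Nat.mul_le_mul (pow_ncard_reducedOfSize_le hk n)
          (pow_ncard_reducedOfSize_le hl n))
    _ = _ := by ring

/-! ### Density of the joined tuples -/

/-- `joinTuples` need not be injective, because the pair of size one is fixed by both placements.
But a preimage is determined by which sub-multiset comes from the left, leaving at most `2 ^ (k +
l)` choices. -/
theorem ncard_mul_ncard_le_of_joinTuples {k l : ℕ} {A : Set (Sym ReducedTreePair k)}
    {B : Set (Sym ReducedTreePair l)} {E : Set (Sym ReducedTreePair (k + l))} (hA : A.Finite)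
    (hB : B.Finite) (hE : E.Finite) (h : ∀ t ∈ A, ∀ u ∈ B, joinTuples t u ∈ E) :
    A.ncard * B.ncard ≤ 2 ^ (k + l) * E.ncard := by
  classical
  rw [Set.ncard_eq_toFinset_card A hA, Set.ncard_eq_toFinset_card B hB,
    Set.ncard_eq_toFinset_card E hE, ← card_product]
  let f : Sym ReducedTreePair k × Sym ReducedTreePair l → Sym ReducedTreePair (k + l) :=
    fun p => joinTuples p.1 p.2
  have hf : (hA.toFinset ×ˢ hB.toFinset).image f ⊆ hE.toFinset := by
    intro x hx
    obtain ⟨⟨t, u⟩, htu, rfl⟩ := mem_image.1 hx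
    simp only [mem_product, Set.Finite.mem_toFinset] at htu ⊢
    exact h t htu.1 u htu.2
  refine (card_le_mul_card_image _ (2 ^ (k + l)) fun a _ => ?_).trans
    (Nat.mul_le_mul_left _ (card_le_card hf))
  have hcard : #((a : Multiset ReducedTreePair).powerset.toFinset) ≤ 2 ^ (k + l) := by
    refine (Multiset.toFinset_card_le _).trans ?_
    rw [Multiset.card_powerset, Sym.card_coe]
  have hcoe : ∀ (t : Sym ReducedTreePair k) (u : Sym ReducedTreePair l),
      (joinTuples t u : Multiset ReducedTreePair) =
        (t : Multiset ReducedTreePair).map ReducedTreePair.left +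
          (u : Multiset ReducedTreePair).map ReducedTreePair.right := by
    intro t u
    rw [joinTuples, Sym.coe_append, Sym.coe_map, Sym.coe_map]
  refine le_trans (card_le_card_of_injOn
    (fun p => (p.1 : Multiset ReducedTreePair).map ReducedTreePair.left) ?_ ?_) hcard
  · rintro ⟨t, u⟩ hp
    have hp := (mem_filter.1 hp).2
    simp only [mem_coe, Multiset.mem_toFinset, Multiset.mem_powerset]
    rw [← hp]
    change _ ≤ (joinTuples t u : Multiset ReducedTreePair)
    rw [hcoe]
    exact Multiset.le_add_right _ _
  · rintro ⟨t, u⟩ hp ⟨t', u'⟩ hp' heq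
    have hp : joinTuples t u = a := (mem_filter.1 hp).2
    have hp' : joinTuples t' u' = a := (mem_filter.1 hp').2
    have e := congrArg (fun s : Sym ReducedTreePair (k + l) => (s : Multiset ReducedTreePair))
      (hp.trans hp'.symm)
    simp only [hcoe] at e heq
    rw [heq, add_right_inj] at e
    exact Prod.ext
      (Sym.coe_injective (Multiset.map_injective ReducedTreePair.left_injective heq))
      (Sym.coe_injective (Multiset.map_injective ReducedTreePair.right_injective e))

/-! ### Positive lower density as an eventual lower bound, and visibility of products. -/

theorem proportion_nonneg {k : ℕ} (A : Set (Sym ReducedTreePair k)) (n : ℕ) :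
    0 ≤ proportion A n := by
  unfold proportion
  positivity

theorem proportion_le_one {k : ℕ} (A : Set (Sym ReducedTreePair k)) (n : ℕ) :
    proportion A n ≤ 1 := by
  refine div_le_one_of_le₀ ?_ (by positivity)
  exact_mod_cast Set.ncard_le_ncard Set.inter_subset_right (sphMax_finite k n)

theorem inSpecMax_iff {k : ℕ} {H : Type*} [Group H] :
    InSpecMax k H ↔
      ∃ a : ℝ, 0 < a ∧ ∀ᶠ n in Filter.atTop, a ≤ proportion (generatingTuples k H) n := by
  constructor
  · intro h
    obtain ⟨a, h0, ha⟩ := exists_between h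
    refine ⟨a, h0, (Filter.eventually_lt_of_lt_liminf ha ?_).mono fun n hn => hn.le⟩
    exact Filter.isBoundedUnder_of ⟨0, fun n => proportion_nonneg _ n⟩
  · rintro ⟨a, h0, ha⟩
    refine h0.trans_le (Filter.le_liminf_of_le ?_ ha)
    exact Filter.IsBoundedUnder.isCoboundedUnder_ge
      (Filter.isBoundedUnder_of ⟨1, fun n => proportion_le_one _ n⟩)

/-- The spheres of `0`-tuples are empty, and then the proportion is `0 / 0 = 0`. -/
theorem InSpecMax.one_le {k : ℕ} {H : Type*} [Group H] (h : InSpecMax k H) : 1 ≤ k := by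
  obtain ⟨a, h0, ha⟩ := inSpecMax_iff.1 h
  obtain ⟨n, hn⟩ := ha.exists
  by_contra hk
  obtain rfl : k = 0 := by omega
  have : sphMax 0 n = ∅ := by
    rw [Set.eq_empty_iff_forall_notMem]
    rintro t ⟨-, p, hp, -⟩
    rw [Sym.eq_nil_of_card_zero t] at hp
    exact Sym.notMem_nil p hp
  rw [proportion, this] at hn
  simp at hn
  linarith

theorem InSpecMax.prod {k l : ℕ} {H K : Type*} [Group H] [Group K] (hH : InSpecMax k H)
    (hK : InSpecMax l K) : InSpecMax (k + l) (H × K) := by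
  obtain ⟨D, hD⟩ := exists_ncard_sphMax_add_le hH.one_le hK.one_le
  obtain ⟨a, ha0, ha⟩ := inSpecMax_iff.1 hH
  obtain ⟨b, hb0, hb⟩ := inSpecMax_iff.1 hK
  rw [inSpecMax_iff]
  -- `2 ^ (k + l)` bounds the fibres of `joinTuples` and `D` the ratio of the spheres; `D + 1` keeps
  -- the denominator positive.
  refine ⟨a * b / (2 ^ (k + l) * (D + 1)), by positivity, ?_⟩
  -- Joining raises the radius by one, so the proportion is estimated at `n + 1`.
  rw [← Filter.map_add_atTop_eq_nat 1, Filter.eventually_map]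
  filter_upwards [ha, hb, Filter.eventually_ge_atTop 3] with n han hbn hn
  have h1 : (((generatingTuples k H ∩ sphMax k n).ncard : ℝ) *
      (generatingTuples l K ∩ sphMax l n).ncard) ≤
      2 ^ (k + l) * ((generatingTuples (k + l) (H × K) ∩ sphMax (k + l) (n + 1)).ncard : ℝ) := by
    exact_mod_cast ncard_mul_ncard_le_of_joinTuples
      ((sphMax_finite k n).subset Set.inter_subset_right)
      ((sphMax_finite l n).subset Set.inter_subset_right)
      ((sphMax_finite (k + l) (n + 1)).subset Set.inter_subset_right)
      fun t ht u hu => ⟨joinTuples_mem_generatingTuples ht.1 hu.1,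
        joinTuples_mem_sphMax (by omega) ht.2 hu.2⟩
  have h2 : ((sphMax (k + l) (n + 1)).ncard : ℝ) ≤
      D * ((sphMax k n).ncard * (sphMax l n).ncard) := by exact_mod_cast hD n hn
  have pos : ∀ {m : ℕ} {A : Set (Sym ReducedTreePair m)} {c : ℝ}, 0 < c → c ≤ proportion A n →
      0 < ((sphMax m n).ncard : ℝ) ∧ c * (sphMax m n).ncard ≤ ((A ∩ sphMax m n).ncard : ℝ) := by
    intro m A c hc h
    have h0 : (0 : ℝ) < (sphMax m n).ncard := by
      refine lt_of_le_of_ne (Nat.cast_nonneg _) fun h0 => ?_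
      rw [proportion, ← h0, div_zero] at h
      linarith
    exact ⟨h0, (le_div_iff₀ h0).1 h⟩
  obtain ⟨hk0, hkA⟩ := pos ha0 han
  obtain ⟨hl0, hlB⟩ := pos hb0 hbn
  have h3 := mul_le_mul hkA hlB (by positivity) (by positivity)
  set x : ℝ := ((sphMax k n).ncard : ℝ)
  set y : ℝ := ((sphMax l n).ncard : ℝ)
  set s : ℝ := ((sphMax (k + l) (n + 1)).ncard : ℝ) with hs
  set e : ℝ := ((generatingTuples (k + l) (H × K) ∩ sphMax (k + l) (n + 1)).ncard : ℝ) with he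
  have hxy : 0 < x * y := mul_pos hk0 hl0
  have hes : e ≤ s := by
    exact Nat.cast_le.2 (Set.ncard_le_ncard Set.inter_subset_right (sphMax_finite (k + l) (n + 1)))
  have hpos : 0 < s := by
    refine lt_of_lt_of_le ?_ hes
    have : 0 < (2 : ℝ) ^ (k + l) * e :=
      lt_of_lt_of_le (by positivity : 0 < (a * x) * (b * y)) (h3.trans h1)
    exact pos_of_mul_pos_right this (by positivity)
  rw [proportion, ← hs, ← he, div_le_div_iff₀ (by positivity) hpos]
  calc a * b * s ≤ a * b * (D * (x * y)) := mul_le_mul_of_nonneg_left h2 (by positivity)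
    _ ≤ (D + 1) * ((a * x) * (b * y)) := by
        have : 0 ≤ (a * x) * (b * y) := by positivity
        nlinarith
    _ ≤ (D + 1) * (2 ^ (k + l) * e) :=
        mul_le_mul_of_nonneg_left (h3.trans h1) (by positivity)
    _ = e * (2 ^ (k + l) * (D + 1)) := by ring

end ThompsonF

end

theorem mainTheorem7 {H : Type*} {K : Type*} [Group H] [Group K] (k l₀ : ℕ)
    (hH : ThompsonF.InSpecMax k H)
    (hK : ∀ l : ℕ, l₀ ≤ l → ThompsonF.InSpecMax l K) :
    ThompsonF.IsPersistent (H × K) ∧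
      ∀ l : ℕ, l₀ + k ≤ l → ThompsonF.InSpecMax l (H × K) := by
  have key : ∀ l : ℕ, l₀ + k ≤ l → ThompsonF.InSpecMax l (H × K) := by
    intro l hl
    obtain ⟨m, rfl⟩ : ∃ m, l = k + m := ⟨l - k, by omega⟩
    exact hH.prod (hK m (by omega))
  exact ⟨⟨l₀ + k, key⟩, key⟩
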